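/- All graphs are finite and simple. A complex unit gain graph $G^{\varphi}$ is a graph $G$ together with a function $\varphi$ from the oriented edges of $G$ (each edge $uv$ gives two, $\overrightarrow{uv}$ and $\overrightarrow{vu}$) to the unit circle $\{z\in\mathbb{C}:|z|=1\}$ such that $\varphi(\overrightarrow{uv})=\varphi(\overrightarrow{vu})^{-1}$. Its adjacency matrix $A(G^{\varphi})$ is the Hermitian matrix indexed by $V(G)$ whose $(u,v)$ entry is $\varphi(\overrightarrow{uv})$ if $uv\in E(G)$ and $0$ otherwise, and $n(G^{\varphi})$ denotes the number of negative eigenvalues of $A(G^{\varphi})$, counted with multiplicity. Let $m(H)$ be the maximum number of edges in a matching of a graph $H$, and let $c(G)=|E(G)|-|V(G)|+\omega(G)$, where $\omega(G)$ is the number of connected components of $G$. A cycle $v_1v_2\cdots v_kv_1$ ($k\ge 3$) of $G$ is of Type A if $k$ is even and $\varphi(\overrightarrow{v_1v_2})\varphi(\overrightarrow{v_2v_3})\cdots\varphi(\overrightarrow{v_{k-1}v_k})\varphi(\overrightarrow{v_kv_1})=(-1)^{k/2}$. Let $O(G)$ be the set of vertices of $G$ lying on cycles, and let $G-O(G)$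 be the graph obtained from $G$ by deleting these vertices. If the cycles of $G$ are pairwise vertex-disjoint, let $T_G$ be the acyclic graph obtained from $G$ by contracting each cycle into a single vertex. **Theorem 3.11.** Let $G^{\varphi}$ be a connected complex unit gain graph. Then $n(G^{\varphi})=m(G)-c(G)$ if and only if the following three conditions all hold: (a) any two distinct cycles of $G$ have no common vertex; (b) every cycle of $G^{\varphi}$ is of Type A; (c) $m(T_G)=m(G-O(G))$. -/

import Mathlib

namespace SimpleGraph

variable {V : Type*}

/-- The matching number `m(G)`: the largest number of edges of a matching of `G`
(used for graphs with finitely many vertices). -/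
noncomputable def matchingNumber (G : SimpleGraph V) : ℕ :=
  sSup {k : ℕ | ∃ M : G.Subgraph, M.IsMatching ∧ M.edgeSet.ncard = k}

/-- The cyclomatic number `c(G) = |E(G)| - |V(G)| + ω(G)`, where `ω(G)` is the number of
connected components (used for graphs with finitely many vertices). -/
noncomputable def cyclomaticNumber (G : SimpleGraph V) : ℤ :=
  (G.edgeSet.ncard : ℤ) - (Nat.card V : ℤ) + (Nat.card G.ConnectedComponent : ℤ)

/-- The cycles of `G`, as subgraphs of `G`: those traversed by a closed walk that is a cycle. -/
def cycleSubgraphs (G : SimpleGraph V) : Set G.Subgraph :=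
  {C | ∃ (v : V) (w : G.Walk v v), w.IsCycle ∧ w.toSubgraph = C}

/-- Any two distinct cycles of `G` have no common vertex. -/
def CyclesVertexDisjoint (G : SimpleGraph V) : Prop :=
  G.cycleSubgraphs.PairwiseDisjoint Subgraph.verts

/-- `O(G)`: the set of the vertices that lie on some cycle of `G`. -/
def cycleVertices (G : SimpleGraph V) : Set V :=
  {v | ∃ C ∈ G.cycleSubgraphs, v ∈ C.verts}

/-- The vertices `u` and `v` lie on a common cycle of `G`. -/
def OnCommonCycle (G : SimpleGraph V) (u v : V) : Prop :=
  ∃ C ∈ G.cycleSubgraphs, u ∈ C.verts ∧ v ∈ C.verts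

/-- `T_G`: the simple graph obtained from `G` by contracting each cycle of `G` into one vertex.
Its vertices are the classes of vertices of `G` modulo identification of vertices on a common
cycle; two distinct classes are adjacent when some edge of `G` joins them. -/
def cycleContraction (G : SimpleGraph V) : SimpleGraph (Quot G.OnCommonCycle) :=
  G.map (Quot.mk G.OnCommonCycle)

end SimpleGraph

/-- A complex unit gain graph on the vertex set `V`: a simple graph together with a map from its
oriented edges to the circle group that takes inverse values on the two orientations of an edge. -/
structure UnitGainGraph (V : Type*) where
  /-- The underlying graph. -/
  graph : SimpleGraph V
  /-- The gain function. -/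
  gain : graph.Dart → Circle
  gain_symm : ∀ d : graph.Dart, gain d.symm = (gain d)⁻¹

namespace UnitGainGraph

variable {V : Type*}

open Classical in
/-- The adjacency matrix: the `(u, v)` entry is the gain of the oriented edge from `u` to `v` if
`u` and `v` are adjacent, and `0` otherwise. -/
noncomputable def adjMatrix (Φ : UnitGainGraph V) : Matrix V V ℂ :=
  Matrix.of fun u v => if h : Φ.graph.Adj u v then (Φ.gain ⟨(u, v), h⟩ : ℂ) else 0

theorem adjMatrix_isHermitian (Φ : UnitGainGraph V) : Φ.adjMatrix.IsHermitian := by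
  ext u v
  by_cases h : Φ.graph.Adj u v
  · have hs : Φ.gain ⟨(v, u), h.symm⟩ = (Φ.gain ⟨(u, v), h⟩)⁻¹ := Φ.gain_symm ⟨(u, v), h⟩
    simp only [Matrix.conjTranspose_apply, adjMatrix, Matrix.of_apply, dif_pos h, dif_pos h.symm, hs,
      Circle.coe_inv_eq_conj]
    simp
  · have h' : ¬ Φ.graph.Adj v u := fun k => h k.symm
    simp [adjMatrix, h, h']

/-- The negative inertia index: the number of negative eigenvalues of the adjacency matrix,
counted with multiplicity. -/
noncomputable def negInertia [Fintype V] [DecidableEq V] (Φ : UnitGainGraph V) : ℕ :=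
  Nat.card {i : V // Φ.adjMatrix_isHermitian.eigenvalues i < 0}

/-- The gain of a walk: the product of the gains of its consecutive oriented edges. -/
noncomputable def walkGain (Φ : UnitGainGraph V) {u v : V} (w : Φ.graph.Walk u v) : Circle :=
  (w.darts.map Φ.gain).prod

/-- Type A, for a closed walk running once around a cycle of length `n`:
`n` is even and the gain of the cycle is `(-1)^(n/2)`. -/
def IsTypeA (Φ : UnitGainGraph V) {v : V} (w : Φ.graph.Walk v v) : Prop :=
  Even w.length ∧ (Φ.walkGain w : ℂ) = (-1) ^ (w.length / 2)

/-- Every cycle is of Type A. (Gain `±1` depends neither on the starting vertex nor on the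
direction in which the cycle is traversed.) -/
def CyclesTypeA (Φ : UnitGainGraph V) : Prop :=
  ∀ (v : V) (w : Φ.graph.Walk v v), w.IsCycle → Φ.IsTypeA w

end UnitGainGraph

/-! Write `n`, `m`, `c` for negative index, matching number and cyclomatic number. All subgraphs
keep the vertex set `V`: deleting vertices means removing the edges that meet them (`isolate`), and
one gain function on all pairs serves every subgraph. The number `n` is read as the largest
dimension of a negative definite subspace (`negIndex_eq_card`), so it is monotone under vertex
deletion and subadditive when the edge set is split.

The inequality `m ≤ n + c` (`matchingNumber_le_negIndex_add_cyclomaticNumber`) is an induction.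
Deleting a vertex of a cycle lowers `m` by at most 1, lowers `c` by at least 1 and does not raise
`n`. In a forest, deleting a leaf with its neighbour lowers `m` by at most 1 and `n` by at least 1.

In a graph with equality (`IsTight`) these estimates have no slack, and equality passes to the
smaller graph. Distinct cycles that meet diverge at some common vertex, whose deletion would lower
`c` by 2; hence (a). Peeling down to a single cycle gives (b): deleting a vertex of an odd cycle
does not lower `m`, and a cycle of length `2r` with gain other than `(-1)^r` has `n ≥ r`.

Condition (c) is replaced by `HasBridgeCover`: some `K` off the cycles covers all bridges and `|K| ≤
m(G - O(G))`. Since `T_G` is a forest whose edges come from the bridges of `G`, König's theorem for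
forests makes this equivalent to (c) (`hasBridgeCover_iff_matchingNumber_cycleContraction`). Tight
graphs have such a cover (`IsTight.hasBridgeCover`), by induction on an end piece: a pendant edge,
or a cycle hanging on one bridge.

Conversely, split off the cycles. One of Type A and length `2r` has `n ≤ r - 1` and accounts for 1
in `c`; the remaining forest of bridges has `n ≤ |K|`. So `n + c ≤ |K| + |O(G)|/2 ≤ m(G)`, because
perfect matchings of the even cycles can be added to any matching of `G - O(G)`. -/

open Matrix

/-! ### Negative index of a Hermitian form -/

namespace Matrix

variable {V : Type*} [Fintype V]

/-- The real part of the sesquilinear form of `A` at `(f, f)`. -/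
noncomputable def reForm (A : Matrix V V ℂ) (f : V → ℂ) : ℝ :=
  (star f ⬝ᵥ A *ᵥ f).re

theorem reForm_zero (A : Matrix V V ℂ) : A.reForm 0 = 0 := by simp [reForm]

theorem reForm_add (A B : Matrix V V ℂ) (f : V → ℂ) :
    (A + B).reForm f = A.reForm f + B.reForm f := by
  simp [reForm, add_mulVec, dotProduct_add]

/-- The largest dimension of a subspace on which the form of `A` is negative definite. -/
noncomputable def negIndex (A : Matrix V V ℂ) : ℕ :=
  sSup {d | ∃ W : Submodule ℂ (V → ℂ), Module.finrank ℂ W = d ∧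
    ∀ f ∈ W, f ≠ 0 → A.reForm f < 0}

theorem bddAbove_negIndex (A : Matrix V V ℂ) :
    BddAbove {d | ∃ W : Submodule ℂ (V → ℂ), Module.finrank ℂ W = d ∧
      ∀ f ∈ W, f ≠ 0 → A.reForm f < 0} := by
  refine ⟨Module.finrank ℂ (V → ℂ), ?_⟩
  rintro d ⟨W, rfl, -⟩
  exact Submodule.finrank_le W

theorem finrank_le_negIndex {A : Matrix V V ℂ} {W : Submodule ℂ (V → ℂ)}
    (h : ∀ f ∈ W, f ≠ 0 → A.reForm f < 0) : Module.finrank ℂ W ≤ A.negIndex :=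
  le_csSup A.bddAbove_negIndex ⟨W, rfl, h⟩

theorem exists_finrank_eq_negIndex (A : Matrix V V ℂ) :
    ∃ W : Submodule ℂ (V → ℂ), Module.finrank ℂ W = A.negIndex ∧
      ∀ f ∈ W, f ≠ 0 → A.reForm f < 0 := by
  have hne : {d | ∃ W : Submodule ℂ (V → ℂ), Module.finrank ℂ W = d ∧
      ∀ f ∈ W, f ≠ 0 → A.reForm f < 0}.Nonempty :=
    ⟨0, ⊥, finrank_bot ℂ _, fun f hf h => absurd ((Submodule.mem_bot ℂ).1 hf) h⟩
  exact Nat.sSup_mem hne A.bddAbove_negIndex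

/-- A negative definite subspace meets `U` only in 0, so the two dimensions add up to at most that
of the whole space. -/
theorem negIndex_add_finrank_le {A : Matrix V V ℂ} {U : Submodule ℂ (V → ℂ)}
    (h : ∀ f ∈ U, 0 ≤ A.reForm f) :
    A.negIndex + Module.finrank ℂ U ≤ Fintype.card V := by
  obtain ⟨W, hW, hneg⟩ := A.exists_finrank_eq_negIndex
  have hdisj : Disjoint W U := by
    rw [Submodule.disjoint_def]
    intro f hf hu
    by_contra h0
    exact absurd (h f hu) (not_le.2 (hneg f hf h0))
  have h1 := Submodule.finrank_sup_add_finrank_inf_eq W U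
  rw [hdisj.eq_bot, finrank_bot] at h1
  have h2 := Submodule.finrank_le (W ⊔ U)
  rw [Module.finrank_pi] at h2
  omega

/-- A negative definite pullback bounds the negative index from below. -/
theorem le_negIndex_of_linearMap {E : Type*} [AddCommGroup E] [Module ℂ E]
    {A : Matrix V V ℂ} (L : E →ₗ[ℂ] (V → ℂ))
    (h : ∀ g, g ≠ 0 → A.reForm (L g) < 0) : Module.finrank ℂ E ≤ A.negIndex := by
  have hinj : Function.Injective L := by
    rw [injective_iff_map_eq_zero]
    intro g hg
    by_contra h0
    have := h g h0
    rw [hg, reForm_zero] at this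
    exact lt_irrefl _ this
  rw [← LinearMap.finrank_range_of_inj hinj]
  apply finrank_le_negIndex
  rintro _ ⟨g, rfl⟩ hg
  exact h g (fun h0 => hg (by rw [h0, map_zero]))

/-- If the form is nonnegative on the common kernel of `r` functionals, its negative index is at
most `r`. -/
theorem negIndex_le_of_ker {r : ℕ} {A : Matrix V V ℂ} (L : (V → ℂ) →ₗ[ℂ] (Fin r → ℂ))
    (h : ∀ f, L f = 0 → 0 ≤ A.reForm f) : A.negIndex ≤ r := by
  have h1 := negIndex_add_finrank_le (A := A) (U := LinearMap.ker L) (fun f hf => h f hf)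
  have h2 := L.finrank_range_add_finrank_ker
  have h3 := Submodule.finrank_le (LinearMap.range L)
  rw [Module.finrank_pi, Fintype.card_fin] at h3
  rw [Module.finrank_pi] at h2
  omega

variable [DecidableEq V]

theorem IsHermitian.reForm_sum_eigenvectors {A : Matrix V V ℂ} (hA : A.IsHermitian) (c : V → ℂ) :
    A.reForm (∑ i, c i • ⇑(hA.eigenvectorBasis i)) = ∑ i, ‖c i‖ ^ 2 * hA.eigenvalues i := by
  have horth : ∀ i j, star ⇑(hA.eigenvectorBasis i) ⬝ᵥ ⇑(hA.eigenvectorBasis j)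
      = if i = j then 1 else 0 := by
    intro i j
    have := orthonormal_iff_ite.1 hA.eigenvectorBasis.orthonormal i j
    rw [← this, EuclideanSpace.inner_eq_star_dotProduct, dotProduct_comm]
  have h1 : A *ᵥ (∑ i, c i • ⇑(hA.eigenvectorBasis i)) =
      ∑ i, (c i * hA.eigenvalues i) • ⇑(hA.eigenvectorBasis i) := by
    rw [mulVec_sum]
    refine Finset.sum_congr rfl fun i _ => ?_
    rw [mulVec_smul, hA.mulVec_eigenvectorBasis, mul_smul]
    rfl
  unfold reForm
  rw [h1, star_sum, sum_dotProduct, Complex.re_sum]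
  refine Finset.sum_congr rfl fun i _ => ?_
  rw [dotProduct_sum, Finset.sum_eq_single i]
  · rw [star_smul, smul_dotProduct, dotProduct_smul, horth, if_pos rfl]
    simp only [smul_eq_mul, mul_one]
    rw [← mul_assoc, Complex.star_def, Complex.conj_mul']
    norm_cast
  · intro j _ hj
    rw [star_smul, smul_dotProduct, dotProduct_smul, horth, if_neg (Ne.symm hj)]
    simp
  · simp

/-- Serves both halves of `negIndex_eq_card`. Elements of the span of the selected eigenvectors get
coefficients on all of `V`, as `reForm_sum_eigenvectors` requires; the clause on zero carries linear
independence. -/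
theorem IsHermitian.exists_sum_eigenvectors_injective {A : Matrix V V ℂ} (hA : A.IsHermitian)
    (p : V → Prop) [DecidablePred p] :
    ∃ U : Submodule ℂ (V → ℂ), Module.finrank ℂ U = Fintype.card {i // p i} ∧
      ∀ f ∈ U, ∃ c : V → ℂ, (∀ i, ¬ p i → c i = 0) ∧ (f = 0 ↔ c = 0) ∧
        f = ∑ i, c i • ⇑(hA.eigenvectorBasis i) := by
  let b : Module.Basis V ℂ (V → ℂ) :=
    hA.eigenvectorBasis.toBasis.map (WithLp.linearEquiv 2 ℂ (V → ℂ))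
  have hb : ∀ i, b i = ⇑(hA.eigenvectorBasis i) := by
    intro i
    simp [b]
  have hli : LinearIndependent ℂ (fun i : {i // p i} => b i) :=
    b.linearIndependent.comp _ Subtype.val_injective
  refine ⟨Submodule.span ℂ (Set.range fun i : {i // p i} => b i), finrank_span_eq_card hli, ?_⟩
  intro f hf
  obtain ⟨g, rfl⟩ := (Submodule.mem_span_range_iff_exists_fun ℂ).1 hf
  have key : ∑ i, g i • b i = ∑ i, (if h : p i then g ⟨i, h⟩ else 0) • b i := by
    rw [← Finset.sum_subset (Finset.subset_univ (Finset.univ.filter p))]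
    · rw [Finset.sum_subtype (Finset.univ.filter p) (p := p) (by simp)]
      refine Finset.sum_congr rfl fun i _ => ?_
      rw [dif_pos i.2]
    · intro i _ hi
      rw [dif_neg (by simpa using hi), zero_smul]
  refine ⟨fun i => if h : p i then g ⟨i, h⟩ else 0, fun i hi => dif_neg hi, ?_, ?_⟩
  · rw [key]
    constructor
    · intro h
      funext i
      exact (Fintype.linearIndependent_iff.1 b.linearIndependent) _ h i
    · intro h
      simp only [funext_iff, Pi.zero_apply] at h
      simp [h]
  · rw [key]
    simp only [hb]

theorem IsHermitian.exists_reForm_nonneg {A : Matrix V V ℂ} (hA : A.IsHermitian) :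
    ∃ U : Submodule ℂ (V → ℂ), Module.finrank ℂ U = Fintype.card {i // ¬ hA.eigenvalues i < 0} ∧
      ∀ f ∈ U, 0 ≤ A.reForm f := by
  obtain ⟨U, hU, h⟩ := hA.exists_sum_eigenvectors_injective (fun i => ¬ hA.eigenvalues i < 0)
  refine ⟨U, hU, fun f hf => ?_⟩
  obtain ⟨c, hc, -, rfl⟩ := h f hf
  rw [hA.reForm_sum_eigenvectors]
  refine Finset.sum_nonneg fun i _ => ?_
  by_cases hi : hA.eigenvalues i < 0
  · rw [hc i (by simpa using hi)]
    simp
  · exact mul_nonneg (by positivity) (not_lt.1 hi)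

/-- Sylvester's law of inertia: the eigenvectors with negative eigenvalue span a negative definite
space, and the others span a nonnegative one that bounds the dimension of any negative definite
space. -/
theorem IsHermitian.negIndex_eq_card {A : Matrix V V ℂ} (hA : A.IsHermitian) :
    A.negIndex = Fintype.card {i // hA.eigenvalues i < 0} := by
  apply le_antisymm
  · obtain ⟨U, hU, h⟩ := hA.exists_reForm_nonneg
    have h1 := negIndex_add_finrank_le h
    have h2 := Fintype.card_subtype_compl (fun i => hA.eigenvalues i < 0)
    have h3 := Fintype.card_subtype_le (fun i => hA.eigenvalues i < 0)
    omega
  · obtain ⟨U, hU, h⟩ := hA.exists_sum_eigenvectors_injective (fun i => hA.eigenvalues i < 0)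
    rw [← hU]
    apply finrank_le_negIndex
    intro f hf h0
    obtain ⟨c, hc, hz, rfl⟩ := h f hf
    rw [hA.reForm_sum_eigenvectors]
    have hne : c ≠ 0 := fun h1 => h0 (hz.2 h1)
    obtain ⟨j, hj⟩ := Function.ne_iff.1 hne
    have hjn : hA.eigenvalues j < 0 := by
      by_contra hcon
      exact hj (hc j hcon)
    refine Finset.sum_neg' (fun i _ => ?_) ⟨j, Finset.mem_univ j, ?_⟩
    · by_cases hi : hA.eigenvalues i < 0
      · exact mul_nonpos_of_nonneg_of_nonpos (by positivity) hi.le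
      · rw [hc i hi]
        simp
    · have : 0 < ‖c j‖ := norm_pos_iff.2 hj
      exact mul_neg_of_pos_of_neg (by positivity) hjn

/-- The nonnegative eigenspaces of `A` and `B` intersect in a space of codimension at most the sum
of the indices, and `A + B` is nonnegative there. -/
theorem IsHermitian.negIndex_add_le {A B : Matrix V V ℂ} (hA : A.IsHermitian)
    (hB : B.IsHermitian) : (A + B).negIndex ≤ A.negIndex + B.negIndex := by
  obtain ⟨U, hU, hu⟩ := hA.exists_reForm_nonneg
  obtain ⟨W, hW, hw⟩ := hB.exists_reForm_nonneg
  have h1 : (A + B).negIndex + Module.finrank ℂ ↥(U ⊓ W) ≤ Fintype.card V := by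
    apply negIndex_add_finrank_le
    intro f hf
    rw [reForm_add]
    exact add_nonneg (hu f hf.1) (hw f hf.2)
  have h2 := Submodule.finrank_sup_add_finrank_inf_eq U W
  have h3 := Submodule.finrank_le (U ⊔ W)
  rw [Module.finrank_pi] at h3
  rw [Fintype.card_subtype_compl] at hU hW
  rw [← hA.negIndex_eq_card] at hU
  rw [← hB.negIndex_eq_card] at hW
  omega

end Matrix

/-! ### Matchings, vertex covers and vertex deletion -/

namespace SimpleGraph

variable {V W : Type*}

/-- A matching, given as a finite set of pairwise disjoint edges. -/
def IsEdgeMatching (G : SimpleGraph V) (M : Finset (Sym2 V)) : Prop :=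
  (∀ e ∈ M, e ∈ G.edgeSet) ∧ ∀ e ∈ M, ∀ f ∈ M, ∀ v, v ∈ e → v ∈ f → e = f

theorem isEdgeMatching_empty (G : SimpleGraph V) : G.IsEdgeMatching ∅ := by
  simp [IsEdgeMatching]

theorem IsEdgeMatching.mono {G H : SimpleGraph V} {M : Finset (Sym2 V)} (h : G.IsEdgeMatching M)
    (hle : G ≤ H) : H.IsEdgeMatching M :=
  ⟨fun e he => edgeSet_mono hle (h.1 e he), h.2⟩

theorem IsEdgeMatching.subset {G : SimpleGraph V} {M N : Finset (Sym2 V)}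
    (h : G.IsEdgeMatching M) (hN : N ⊆ M) : G.IsEdgeMatching N :=
  ⟨fun e he => h.1 e (hN he), fun e he f hf => h.2 e (hN he) f (hN hf)⟩

theorem IsEdgeMatching.union [DecidableEq V] {G : SimpleGraph V} {M N : Finset (Sym2 V)}
    (hM : G.IsEdgeMatching M) (hN : G.IsEdgeMatching N)
    (h : ∀ e ∈ M, ∀ f ∈ N, ∀ v, v ∈ e → v ∉ f) : G.IsEdgeMatching (M ∪ N) := by
  refine ⟨fun e he => ?_, fun e he f hf v hve hvf => ?_⟩
  · rcases Finset.mem_union.1 he with he | he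
    · exact hM.1 e he
    · exact hN.1 e he
  · rcases Finset.mem_union.1 he with he | he <;> rcases Finset.mem_union.1 hf with hf | hf
    · exact hM.2 e he f hf v hve hvf
    · exact absurd hvf (h e he f hf v hve)
    · exact absurd hve (h f hf e he v hvf)
    · exact hN.2 e he f hf v hve hvf

theorem card_union_of_no_common_vertex [DecidableEq V] {M N : Finset (Sym2 V)}
    (h : ∀ e ∈ M, ∀ f ∈ N, ∀ v, v ∈ e → v ∉ f) : (M ∪ N).card = M.card + N.card := by
  apply Finset.card_union_of_disjoint
  rw [Finset.disjoint_left]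
  intro e he hf
  induction e with
  | h u v => exact h _ he _ hf u (Sym2.mem_mk_left u v) (Sym2.mem_mk_left u v)

/-- The easy half of König's theorem: disjoint edges pick distinct vertices of the cover. -/
theorem IsEdgeMatching.card_le_of_cover {G : SimpleGraph V} {M : Finset (Sym2 V)}
    (hM : G.IsEdgeMatching M) {K : Finset V} (h : ∀ e ∈ M, ∃ v ∈ K, v ∈ e) :
    M.card ≤ K.card := by
  -- `choose!` needs a default vertex for the edges outside `M`.
  rcases isEmpty_or_nonempty V with hV | hV
  · have : M = ∅ := Finset.eq_empty_of_forall_notMem fun e _ => hV.elim e.out.1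
    simp [this]
  choose! f hf using h
  refine Finset.card_le_card_of_injOn f (fun e he => (hf e he).1) ?_
  intro e he e' he' hee
  exact hM.2 e he e' he' (f e) (hf e he).2 (hee ▸ (hf e' he').2)

theorem IsEdgeMatching.two_mul_card_le [DecidableEq V] {G : SimpleGraph V} {M : Finset (Sym2 V)}
    (hM : G.IsEdgeMatching M) {S : Finset V} (h : ∀ e ∈ M, ∀ v ∈ e, v ∈ S) :
    2 * M.card ≤ S.card := by
  have h1 : (M.biUnion fun e => e.toFinset).card = ∑ e ∈ M, e.toFinset.card := by
    apply Finset.card_biUnion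
    intro e he f hf hef
    rw [Function.onFun, Finset.disjoint_left]
    intro v hv hv'
    exact hef (hM.2 e he f hf v (Sym2.mem_toFinset.1 hv) (Sym2.mem_toFinset.1 hv'))
  have h2 : ∑ e ∈ M, e.toFinset.card = ∑ e ∈ M, 2 := by
    refine Finset.sum_congr rfl fun e he => ?_
    exact Sym2.card_toFinset_of_not_isDiag e (G.not_isDiag_of_mem_edgeSet (hM.1 e he))
  have h3 : (M.biUnion fun e => e.toFinset) ⊆ S := by
    intro v hv
    obtain ⟨e, he, hve⟩ := Finset.mem_biUnion.1 hv
    exact h e he v (Sym2.mem_toFinset.1 hve)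
  have h4 := Finset.card_le_card h3
  rw [h1, h2, Finset.sum_const, smul_eq_mul] at h4
  omega

theorem IsEdgeMatching.image [DecidableEq W] {G : SimpleGraph V} {G' : SimpleGraph W}
    {M : Finset (Sym2 V)} (hM : G.IsEdgeMatching M) {f : V → W} {S : Set V}
    (hS : ∀ e ∈ M, ∀ v ∈ e, v ∈ S) (hf : Set.InjOn f S)
    (hadj : ∀ u v, s(u, v) ∈ M → G'.Adj (f u) (f v)) :
    G'.IsEdgeMatching (M.image (Sym2.map f)) ∧ (M.image (Sym2.map f)).card = M.card := by
  have key : ∀ e ∈ M, ∀ e' ∈ M, ∀ w, w ∈ Sym2.map f e → w ∈ Sym2.map f e' → e = e' := by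
    intro e he e' he' w hw hw'
    obtain ⟨v, hv, rfl⟩ := Sym2.mem_map.1 hw
    obtain ⟨v', hv', hvv⟩ := Sym2.mem_map.1 hw'
    have := hf (hS e' he' v' hv') (hS e he v hv) hvv
    subst this
    exact hM.2 e he e' he' _ hv hv'
  refine ⟨⟨?_, ?_⟩, ?_⟩
  · intro e he
    obtain ⟨e, h, rfl⟩ := Finset.mem_image.1 he
    induction e with
    | h u v => exact hadj u v h
  · intro e he e' he' w hw hw'
    obtain ⟨e, h, rfl⟩ := Finset.mem_image.1 he
    obtain ⟨e', h', rfl⟩ := Finset.mem_image.1 he'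
    rw [key e h e' h' w hw hw']
  · apply Finset.card_image_of_injOn
    intro e he e' he' hee
    have hw : (Sym2.map f e).out.1 ∈ Sym2.map f e := Sym2.out_fst_mem _
    exact key e he e' he' _ hw (by simpa only [hee] using hw)

section Finite

variable [Finite V]

theorem IsEdgeMatching.card_le {G : SimpleGraph V} {M : Finset (Sym2 V)}
    (hM : G.IsEdgeMatching M) : M.card ≤ G.matchingNumber := by
  have hbdd : BddAbove {k : ℕ | ∃ M : G.Subgraph, M.IsMatching ∧ M.edgeSet.ncard = k} := by
    refine ⟨G.edgeSet.ncard, ?_⟩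
    rintro k ⟨M, -, rfl⟩
    exact Set.ncard_le_ncard M.edgeSet_subset (Set.toFinite _)
  refine le_csSup hbdd ⟨⟨{v | ∃ e ∈ M, v ∈ e}, fun u v => s(u, v) ∈ M, ?_, ?_, ?_⟩, ?_, ?_⟩
  · exact fun h => hM.1 _ h
  · exact fun h => ⟨_, h, Sym2.mem_mk_left _ _⟩
  · exact ⟨fun u v h => by rwa [Sym2.eq_swap]⟩
  · rintro v ⟨e, he, hve⟩
    obtain ⟨w, rfl⟩ := Sym2.mem_iff_exists.1 hve
    refine ⟨w, he, fun w' hw' => ?_⟩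
    exact (Sym2.congr_right.1 (hM.2 _ he _ hw' v hve (Sym2.mem_mk_left _ _))).symm
  · rw [← Set.ncard_coe_finset]
    congr 1
    ext e
    induction e with
    | h u v => rfl

theorem exists_isEdgeMatching (G : SimpleGraph V) :
    ∃ M, G.IsEdgeMatching M ∧ M.card = G.matchingNumber := by
  have hbdd : BddAbove {k : ℕ | ∃ M : G.Subgraph, M.IsMatching ∧ M.edgeSet.ncard = k} := by
    refine ⟨G.edgeSet.ncard, ?_⟩
    rintro k ⟨M, -, rfl⟩
    exact Set.ncard_le_ncard M.edgeSet_subset (Set.toFinite _)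
  have hne : {k : ℕ | ∃ M : G.Subgraph, M.IsMatching ∧ M.edgeSet.ncard = k}.Nonempty :=
    ⟨_, ⊥, by intro v hv; exact absurd hv (by simp), rfl⟩
  obtain ⟨N, hN, hcard⟩ := Nat.sSup_mem hne hbdd
  refine ⟨(Set.toFinite N.edgeSet).toFinset, ⟨?_, ?_⟩, ?_⟩
  · intro e he
    exact N.edgeSet_subset ((Set.Finite.mem_toFinset _).1 he)
  · intro e he f hf v hve hvf
    rw [Set.Finite.mem_toFinset] at he hf
    obtain ⟨w, rfl⟩ := Sym2.mem_iff_exists.1 hve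
    obtain ⟨w', rfl⟩ := Sym2.mem_iff_exists.1 hvf
    rw [hN.eq_of_adj_left (Subgraph.mem_edgeSet.1 he) (Subgraph.mem_edgeSet.1 hf)]
  · rw [← Set.ncard_eq_toFinset_card, hcard]
    rfl

theorem matchingNumber_le {G : SimpleGraph V} {n : ℕ}
    (h : ∀ M, G.IsEdgeMatching M → M.card ≤ n) : G.matchingNumber ≤ n := by
  obtain ⟨M, hM, hc⟩ := G.exists_isEdgeMatching
  exact hc ▸ h M hM

theorem matchingNumber_mono {G H : SimpleGraph V} (h : G ≤ H) :
    G.matchingNumber ≤ H.matchingNumber :=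
  matchingNumber_le fun _ hM => (hM.mono h).card_le

theorem matchingNumber_bot : (⊥ : SimpleGraph V).matchingNumber = 0 := by
  refine Nat.le_zero.1 (matchingNumber_le fun M hM => ?_)
  rw [Nat.le_zero, Finset.card_eq_zero, Finset.eq_empty_iff_forall_notMem]
  intro e he
  simpa using hM.1 e he

end Finite

/-- The spanning subgraph obtained by removing every edge with an end in `S`. -/
def isolate (G : SimpleGraph V) (S : Set V) : SimpleGraph V where
  Adj u v := G.Adj u v ∧ u ∉ S ∧ v ∉ S
  symm := ⟨fun _ _ h => ⟨h.1.symm, h.2.2, h.2.1⟩⟩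
  loopless := ⟨fun _ h => h.1.ne rfl⟩

@[simp]
theorem isolate_adj {G : SimpleGraph V} {S : Set V} {u v : V} :
    (G.isolate S).Adj u v ↔ G.Adj u v ∧ u ∉ S ∧ v ∉ S := Iff.rfl

theorem isolate_le (G : SimpleGraph V) (S : Set V) : G.isolate S ≤ G := fun _ _ h => h.1

theorem isolate_lt {G : SimpleGraph V} {S : Set V} {u v : V} (h : G.Adj u v) (hu : u ∈ S) :
    G.isolate S < G := by
  refine lt_of_le_of_ne (G.isolate_le S) fun heq => ?_
  rw [← heq] at h
  exact h.2.1 hu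

theorem mem_edgeSet_isolate {G : SimpleGraph V} {S : Set V} {e : Sym2 V} :
    e ∈ (G.isolate S).edgeSet ↔ e ∈ G.edgeSet ∧ ∀ v ∈ e, v ∉ S := by
  induction e with
  | h u v => simp

theorem le_isolate_iff {C G : SimpleGraph V} {S : Set V} :
    C ≤ G.isolate S ↔ C ≤ G ∧ Disjoint C.support S := by
  constructor
  · refine fun h => ⟨h.trans (G.isolate_le S), Set.disjoint_left.2 ?_⟩
    rintro u ⟨v, huv⟩ hu
    exact (h huv).2.1 hu
  · intro h u v huv
    exact ⟨h.1 huv, Set.disjoint_left.1 h.2 ⟨v, huv⟩, Set.disjoint_left.1 h.2 ⟨u, huv.symm⟩⟩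

section Finite

variable [Finite V]

/-- The edges of a matching that avoid `S` survive the deletion; those that meet `S` are covered by
`K`. -/
theorem matchingNumber_le_isolate_add {G : SimpleGraph V} {S : Set V} {K : Finset V}
    (h : ∀ u v, G.Adj u v → u ∈ S → u ∈ K ∨ v ∈ K) :
    G.matchingNumber ≤ (G.isolate S).matchingNumber + K.card := by
  classical
  refine matchingNumber_le fun M hM => ?_
  rw [← Finset.card_filter_add_card_filter_not (s := M) (fun e => ∀ v ∈ e, v ∉ S)]
  apply add_le_add
  · refine IsEdgeMatching.card_le ⟨fun e he => ?_, (hM.subset (Finset.filter_subset _ _)).2⟩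
    rw [Finset.mem_filter] at he
    exact mem_edgeSet_isolate.2 ⟨hM.1 e he.1, he.2⟩
  · refine (hM.subset (Finset.filter_subset _ _)).card_le_of_cover fun e he => ?_
    rw [Finset.mem_filter] at he
    obtain ⟨he, hn⟩ := he
    push Not at hn
    obtain ⟨u, hu, huS⟩ := hn
    obtain ⟨v, rfl⟩ := Sym2.mem_iff_exists.1 hu
    rcases h u v (hM.1 _ he) huS with hk | hk
    · exact ⟨u, hk, Sym2.mem_mk_left _ _⟩
    · exact ⟨v, hk, Sym2.mem_mk_right _ _⟩

theorem matchingNumber_le_isolate_singleton (G : SimpleGraph V) (x : V) :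
    G.matchingNumber ≤ (G.isolate {x}).matchingNumber + 1 := by
  have := matchingNumber_le_isolate_add (G := G) (S := {x}) (K := {x})
    (fun u v _ hu => Or.inl (by simpa using hu))
  simpa using this

/-- Moves `G - O(G)` from a subtype back to the vertex set `V`, where the inductions take place. -/
theorem matchingNumber_induce_compl (G : SimpleGraph V) (S : Set V) :
    (G.induce Sᶜ).matchingNumber = (G.isolate S).matchingNumber := by
  classical
  apply le_antisymm
  · refine matchingNumber_le fun M hM => ?_
    obtain ⟨h1, h2⟩ := hM.image (G' := G.isolate S) (f := Subtype.val) (S := Set.univ)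
      (fun _ _ _ _ => Set.mem_univ _) Subtype.val_injective.injOn
      (fun u v h => ⟨hM.1 _ h, u.2, v.2⟩)
    exact h2 ▸ h1.card_le
  · refine matchingNumber_le fun M hM => ?_
    let f : Sym2 ↥(Sᶜ : Set V) → Sym2 V := Sym2.map Subtype.val
    have hf : Function.Injective f := Sym2.map.injective Subtype.val_injective
    have hr : ∀ e ∈ M, e ∈ Set.range f := by
      intro e he
      have := hM.1 e he
      induction e with
      | h u v => exact ⟨s(⟨u, this.2.1⟩, ⟨v, this.2.2⟩), rfl⟩
    have hcard : (M.preimage f hf.injOn).card = M.card := by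
      rw [Finset.card_preimage, Finset.filter_true_of_mem hr]
    rw [← hcard]
    refine IsEdgeMatching.card_le ⟨fun e he => ?_, fun e he e' he' v hv hv' => ?_⟩
    · have := hM.1 _ (Finset.mem_preimage.1 he)
      induction e with
      | h u v => exact this.1
    · exact hf (hM.2 _ (Finset.mem_preimage.1 he) _ (Finset.mem_preimage.1 he') v.1
        (Sym2.mem_map.2 ⟨v, hv, rfl⟩) (Sym2.mem_map.2 ⟨v, hv', rfl⟩))

end Finite

end SimpleGraph

/-! ### Cycles as spanning subgraphs, and bridges -/

namespace SimpleGraph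

variable {V : Type*}

/-- `C` consists of the edges of one cycle (and of isolated vertices). -/
def IsCycleGraph (C : SimpleGraph V) : Prop :=
  ∃ (v : V) (w : C.Walk v v), w.IsCycle ∧ ∀ e ∈ C.edgeSet, e ∈ w.edges

theorem Walk.IsCycle.isCycleGraph {G : SimpleGraph V} {v : V} {w : G.Walk v v} (hw : w.IsCycle) :
    w.toSubgraph.spanningCoe.IsCycleGraph := by
  have h : ∀ e ∈ w.edges, e ∈ w.toSubgraph.spanningCoe.edgeSet := by
    intro e he
    rw [Subgraph.edgeSet_spanningCoe]
    exact (w.mem_edges_toSubgraph).2 he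
  refine ⟨v, w.transfer _ h, hw.transfer h, fun e he => ?_⟩
  rw [Walk.edges_transfer]
  rw [Subgraph.edgeSet_spanningCoe] at he
  exact (w.mem_edges_toSubgraph).1 he

theorem IsCycleGraph.reachable {C : SimpleGraph V} (hC : C.IsCycleGraph) {u v : V}
    (hu : u ∈ C.support) (hv : v ∈ C.support) : C.Reachable u v := by
  classical
  obtain ⟨x, w, hw, h⟩ := hC
  have key : ∀ u ∈ C.support, C.Reachable x u := by
    rintro u ⟨z, hz⟩
    have := w.fst_mem_support_of_mem_edges (h s(u, z) hz)
    exact ⟨w.takeUntil u this⟩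
  exact (key u hu).symm.trans (key v hv)

theorem IsCycleGraph.not_isBridge {C : SimpleGraph V} (hC : C.IsCycleGraph) {u v : V}
    (h : C.Adj u v) : ¬ C.IsBridge s(u, v) := by
  obtain ⟨x, w, hw, he⟩ := hC
  exact fun hb => hb.notMem_edges_of_isCycle hw (he _ h)

theorem not_isBridge_iff_exists_isCycleGraph {H : SimpleGraph V} {u v : V} (h : H.Adj u v) :
    ¬ H.IsBridge s(u, v) ↔ ∃ C ≤ H, C.IsCycleGraph ∧ C.Adj u v := by
  constructor
  · intro hb
    rw [isBridge_iff, not_not] at hb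
    obtain ⟨x, w, hw, he⟩ := adj_and_reachable_delete_edges_iff_exists_cycle.1 ⟨h, hb⟩
    refine ⟨_, w.toSubgraph.spanningCoe_le, hw.isCycleGraph, ?_⟩
    exact (w.mem_edges_toSubgraph).2 he
  · rintro ⟨C, hle, hC, huv⟩ hb
    exact hC.not_isBridge huv (hb.anti hle)

/-- Every passage through the edge is replaced by a detour between its ends. -/
theorem reachable_deleteEdges_of_not_isBridge {H : SimpleGraph V} {x y u v : V}
    (hb : ¬ H.IsBridge s(x, y)) (h : H.Reachable u v) :
    (H.deleteEdges {s(x, y)}).Reachable u v := by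
  rw [isBridge_iff, not_not] at hb
  obtain ⟨w⟩ := h
  induction w with
  | nil => exact Reachable.refl _
  | @cons a b c hab _ ih =>
    refine Reachable.trans ?_ ih
    by_cases he : s(a, b) = s(x, y)
    · rcases Sym2.eq_iff.1 he with ⟨rfl, rfl⟩ | ⟨rfl, rfl⟩
      · exact hb
      · exact hb.symm
    · exact Adj.reachable (by rw [deleteEdges_adj]; exact ⟨hab, by simpa using he⟩)

theorem Reachable.mem_of_closed {C : SimpleGraph V} {S : Set V} {u v : V} (h : C.Reachable u v)
    (hu : u ∈ S) (hS : ∀ a ∈ S, ∀ b, C.Adj a b → b ∈ S) : v ∈ S := by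
  obtain ⟨w⟩ := h
  induction w with
  | nil => exact hu
  | cons hab _ ih => exact ih (hS _ hu _ hab)

/-- A neighbour of a common vertex along either cycle is again common, so by connectivity the
supports coincide. Hence distinct cycles that meet must diverge at some common vertex. -/
theorem IsCycleGraph.eq_of_forall_adj_iff {C C' : SimpleGraph V} (hC : C.IsCycleGraph)
    (hC' : C'.IsCycleGraph) {x : V} (hx : x ∈ C.support) (hx' : x ∈ C'.support)
    (h : ∀ v, v ∈ C.support → v ∈ C'.support → ∀ u, C.Adj v u ↔ C'.Adj v u) : C = C' := by
  have h1 : ∀ v ∈ C.support, v ∈ C'.support := fun v hv =>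
    ((hC.reachable hx hv).mem_of_closed (S := {v | v ∈ C.support ∧ v ∈ C'.support}) ⟨hx, hx'⟩
      fun a ha b hab => ⟨⟨a, hab.symm⟩, ⟨a, ((h a ha.1 ha.2 b).1 hab).symm⟩⟩).2
  have h2 : ∀ v ∈ C'.support, v ∈ C.support := fun v hv =>
    ((hC'.reachable hx' hv).mem_of_closed (S := {v | v ∈ C.support ∧ v ∈ C'.support}) ⟨hx, hx'⟩
      fun a ha b hab => ⟨⟨a, ((h a ha.1 ha.2 b).2 hab).symm⟩, ⟨a, hab.symm⟩⟩).1
  ext u v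
  constructor
  · exact fun huv => (h u ⟨v, huv⟩ (h1 u ⟨v, huv⟩) v).1 huv
  · exact fun huv => (h u (h2 u ⟨v, huv⟩) ⟨v, huv⟩ v).2 huv

/-- Any two distinct cycles are disjoint, for cycles viewed as spanning subgraphs. -/
def DisjointCycles (H : SimpleGraph V) : Prop :=
  ∀ C ≤ H, ∀ C' ≤ H, C.IsCycleGraph → C'.IsCycleGraph → ∀ v ∈ C.support, v ∈ C'.support → C = C'

theorem DisjointCycles.mono {H H' : SimpleGraph V} (h : H.DisjointCycles) (hle : H' ≤ H) :
    H'.DisjointCycles := fun C hC C' hC' =>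
  h C (hC.trans hle) C' (hC'.trans hle)

theorem Walk.IsCycle.mem_support_spanningCoe_iff {G : SimpleGraph V} {x v : V} {w : G.Walk x x}
    (hw : w.IsCycle) : v ∈ w.toSubgraph.spanningCoe.support ↔ v ∈ w.toSubgraph.verts := by
  classical
  refine ⟨fun ⟨u, hu⟩ => Subgraph.Adj.fst_mem hu, fun hv => ?_⟩
  rw [Walk.mem_verts_toSubgraph] at hv
  have h1 := (w.rotate v hv).toSubgraph_adj_snd ((Walk.isCycle_rotate hv).2 hw).not_nil
  rw [Walk.toSubgraph_rotate] at h1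
  exact ⟨_, h1⟩

theorem IsCycleGraph.exists_walk {C H : SimpleGraph V} (hC : C.IsCycleGraph) (hle : C ≤ H) :
    ∃ (x : V) (w : H.Walk x x), w.IsCycle ∧ w.toSubgraph.spanningCoe = C := by
  obtain ⟨x, w, hw, h⟩ := hC
  refine ⟨x, w.mapLe hle, hw.mapLe hle, ?_⟩
  ext u v
  rw [Subgraph.spanningCoe_adj, Walk.adj_toSubgraph_mapLe, Walk.adj_toSubgraph_iff_mem_edges]
  exact ⟨fun h => w.adj_of_mem_edges h, fun huv => h s(u, v) huv⟩

theorem onCommonCycle_iff {H : SimpleGraph V} {u v : V} :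
    H.OnCommonCycle u v ↔ ∃ C ≤ H, C.IsCycleGraph ∧ u ∈ C.support ∧ v ∈ C.support := by
  constructor
  · rintro ⟨_, ⟨x, w, hw, rfl⟩, hu, hv⟩
    exact ⟨_, w.toSubgraph.spanningCoe_le, hw.isCycleGraph, hw.mem_support_spanningCoe_iff.2 hu,
      hw.mem_support_spanningCoe_iff.2 hv⟩
  · rintro ⟨C, hle, hC, hu, hv⟩
    obtain ⟨x, w, hw, rfl⟩ := hC.exists_walk hle
    exact ⟨_, ⟨x, w, hw, rfl⟩, hw.mem_support_spanningCoe_iff.1 hu,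
      hw.mem_support_spanningCoe_iff.1 hv⟩

theorem mem_cycleVertices_iff {H : SimpleGraph V} {v : V} :
    v ∈ H.cycleVertices ↔ ∃ C ≤ H, C.IsCycleGraph ∧ v ∈ C.support := by
  have h : v ∈ H.cycleVertices ↔ H.OnCommonCycle v v :=
    ⟨fun ⟨C, hC, hv⟩ => ⟨C, hC, hv, hv⟩, fun ⟨C, hC, hv, _⟩ => ⟨C, hC, hv⟩⟩
  rw [h, onCommonCycle_iff]
  simp only [and_self]

theorem cyclesVertexDisjoint_iff {H : SimpleGraph V} :
    H.CyclesVertexDisjoint ↔ H.DisjointCycles := by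
  constructor
  · intro h C hC C' hC' hc hc' v hv hv'
    obtain ⟨x, w, hw, rfl⟩ := hc.exists_walk hC
    obtain ⟨x', w', hw', rfl⟩ := hc'.exists_walk hC'
    rw [hw.mem_support_spanningCoe_iff] at hv
    rw [hw'.mem_support_spanningCoe_iff] at hv'
    by_contra hne
    exact Set.disjoint_left.1 (h ⟨x, w, hw, rfl⟩ ⟨x', w', hw', rfl⟩
      fun heq => hne (congrArg _ heq)) hv hv'
  · rintro h _ ⟨x, w, hw, rfl⟩ _ ⟨x', w', hw', rfl⟩ hne
    refine Set.disjoint_left.2 fun v hv hv' => hne ?_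
    have heq := h _ w.toSubgraph.spanningCoe_le _ w'.toSubgraph.spanningCoe_le hw.isCycleGraph
      hw'.isCycleGraph v (hw.mem_support_spanningCoe_iff.2 hv) (hw'.mem_support_spanningCoe_iff.2 hv')
    refine Subgraph.ext ?_ ?_
    · ext u
      rw [← hw.mem_support_spanningCoe_iff, heq, hw'.mem_support_spanningCoe_iff]
    · ext u v
      rw [← Subgraph.spanningCoe_adj, heq, Subgraph.spanningCoe_adj]

end SimpleGraph

/-! ### Cyclomatic number and the sides of a bridge -/

namespace SimpleGraph

variable {V : Type*}

theorem reachable_or_of_deleteEdges {H : SimpleGraph V} {x y u v : V} (h : H.Reachable u v) :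
    (H.deleteEdges {s(x, y)}).Reachable u v ∨
      ((H.deleteEdges {s(x, y)}).Reachable u x ∧ (H.deleteEdges {s(x, y)}).Reachable v y) ∨
      ((H.deleteEdges {s(x, y)}).Reachable u y ∧ (H.deleteEdges {s(x, y)}).Reachable v x) := by
  obtain ⟨w⟩ := h
  induction w with
  | nil => exact Or.inl (Reachable.refl _)
  | @cons a b c hab _ ih =>
    by_cases he : s(a, b) = s(x, y)
    · rcases Sym2.eq_iff.1 he with ⟨rfl, rfl⟩ | ⟨rfl, rfl⟩
      · rcases ih with ih | ih | ih
        · exact Or.inr (Or.inl ⟨Reachable.refl _, ih.symm⟩)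
        · exact Or.inr (Or.inl ⟨Reachable.refl _, ih.2⟩)
        · exact Or.inl ih.2.symm
      · rcases ih with ih | ih | ih
        · exact Or.inr (Or.inr ⟨Reachable.refl _, ih.symm⟩)
        · exact Or.inl ih.2.symm
        · exact Or.inr (Or.inr ⟨Reachable.refl _, ih.2⟩)
    · have hab' : (H.deleteEdges {s(x, y)}).Reachable a b :=
        Adj.reachable (by rw [deleteEdges_adj]; exact ⟨hab, by simpa using he⟩)
      rcases ih with ih | ih | ih
      · exact Or.inl (hab'.trans ih)
      · exact Or.inr (Or.inl ⟨hab'.trans ih.1, ih.2⟩)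
      · exact Or.inr (Or.inr ⟨hab'.trans ih.1, ih.2⟩)

theorem deleteEdges_singleton_lt {H : SimpleGraph V} {x y : V} (h : H.Adj x y) :
    H.deleteEdges {s(x, y)} < H := by
  refine lt_of_le_of_ne (deleteEdges_le _) fun heq => ?_
  rw [← heq, deleteEdges_adj] at h
  exact h.2 rfl

theorem le_deleteEdges_singleton {H H' : SimpleGraph V} {x y : V} (hle : H' ≤ H)
    (h : ¬ H'.Adj x y) : H' ≤ H.deleteEdges {s(x, y)} := by
  intro u v huv
  rw [deleteEdges_adj]
  refine ⟨hle huv, fun he => h ?_⟩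
  have : s(x, y) ∈ H'.edgeSet := by
    rw [← show s(u, v) = s(x, y) from he]
    exact huv
  exact this

theorem card_connectedComponent_deleteEdges_of_not_isBridge {H : SimpleGraph V} {x y : V}
    (hb : ¬ H.IsBridge s(x, y)) :
    Nat.card (H.deleteEdges {s(x, y)}).ConnectedComponent = Nat.card H.ConnectedComponent := by
  have hle : H.deleteEdges {s(x, y)} ≤ H := deleteEdges_le _
  refine Nat.card_eq_of_bijective (ConnectedComponent.map (Hom.ofLE hle))
    ⟨fun c c' hcc => ?_, ConnectedComponent.surjective_map_ofLE hle⟩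
  induction c using ConnectedComponent.ind with | h u =>
  induction c' using ConnectedComponent.ind with | h v =>
  rw [ConnectedComponent.map_mk, ConnectedComponent.map_mk, ConnectedComponent.eq] at hcc
  exact ConnectedComponent.eq.2 (reachable_deleteEdges_of_not_isBridge hb hcc)

theorem exists_adj_not_adj_of_lt {H H' : SimpleGraph V} (h : H' < H) :
    ∃ x y, H.Adj x y ∧ ¬ H'.Adj x y := by
  by_contra hcon
  push Not at hcon
  exact not_le_of_gt h fun x y => hcon x y

theorem cyclomaticNumber_bot : (⊥ : SimpleGraph V).cyclomaticNumber = 0 := by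
  have h : Nat.card (⊥ : SimpleGraph V).ConnectedComponent = Nat.card V := by
    symm
    refine Nat.card_eq_of_bijective (⊥ : SimpleGraph V).connectedComponentMk
      ⟨fun u v huv => ?_, Quot.mk_surjective⟩
    exact reachable_bot.1 (ConnectedComponent.eq.1 huv)
  simp [cyclomaticNumber, h]

section Finite

variable [Finite V]

/-- The component of `x` after deletion goes to `none`. On the others the map to components of `H`
is injective: two that merge in `H` would include the component of `x`. -/
theorem card_connectedComponent_deleteEdges_le (H : SimpleGraph V) (x y : V) :
    Nat.card (H.deleteEdges {s(x, y)}).ConnectedComponent ≤ Nat.card H.ConnectedComponent + 1 := by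
  classical
  rw [← Finite.card_option]
  let c₀ := (H.deleteEdges {s(x, y)}).connectedComponentMk x
  refine Nat.card_le_card_of_injective (fun c => if c = c₀ then none else
    some (c.map (Hom.ofLE (deleteEdges_le _)))) ?_
  intro c c' hcc
  by_cases h : c = c₀ <;> by_cases h' : c' = c₀
  · rw [h, h']
  · simp [h, h'] at hcc
  · simp [h, h'] at hcc
  · induction c using ConnectedComponent.ind with | h u =>
    induction c' using ConnectedComponent.ind with | h v =>
    simp only [h, h', if_false, Option.some.injEq, ConnectedComponent.map_mk, Hom.ofLE_apply] at hcc
    rw [ConnectedComponent.eq] at hcc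
    have hx : ¬ (H.deleteEdges {s(x, y)}).Reachable u x := fun hr =>
      h (ConnectedComponent.eq.2 hr)
    have hx' : ¬ (H.deleteEdges {s(x, y)}).Reachable v x := fun hr =>
      h' (ConnectedComponent.eq.2 hr)
    rcases reachable_or_of_deleteEdges (x := x) (y := y) hcc with hr | hr | hr
    · exact ConnectedComponent.eq.2 hr
    · exact absurd hr.1 hx
    · exact absurd hr.2 hx'

theorem card_connectedComponent_deleteEdges_of_isBridge {H : SimpleGraph V} {x y : V}
    (h : H.Adj x y) (hb : H.IsBridge s(x, y)) :
    Nat.card (H.deleteEdges {s(x, y)}).ConnectedComponent = Nat.card H.ConnectedComponent + 1 := by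
  classical
  apply le_antisymm (card_connectedComponent_deleteEdges_le H x y)
  have hle : H.deleteEdges {s(x, y)} ≤ H := deleteEdges_le _
  let _ := Fintype.ofFinite H.ConnectedComponent
  let _ := Fintype.ofFinite (H.deleteEdges {s(x, y)}).ConnectedComponent
  rw [Nat.card_eq_fintype_card, Nat.card_eq_fintype_card]
  refine Fintype.card_lt_of_surjective_not_injective _
    (ConnectedComponent.surjective_map_ofLE hle) fun hinj => ?_
  refine hb (ConnectedComponent.eq.1 (hinj ?_))
  rw [ConnectedComponent.map_mk, ConnectedComponent.map_mk, ConnectedComponent.eq]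
  exact h.reachable

theorem ncard_edgeSet_deleteEdges_singleton {H : SimpleGraph V} {x y : V} (h : H.Adj x y) :
    (H.deleteEdges {s(x, y)}).edgeSet.ncard + 1 = H.edgeSet.ncard := by
  rw [edgeSet_deleteEdges]
  exact Set.ncard_sdiff_singleton_add_one h (Set.toFinite _)

theorem cyclomaticNumber_deleteEdges_of_isBridge {H : SimpleGraph V} {x y : V}
    (h : H.Adj x y) (hb : H.IsBridge s(x, y)) :
    (H.deleteEdges {s(x, y)}).cyclomaticNumber = H.cyclomaticNumber := by
  have h1 := ncard_edgeSet_deleteEdges_singleton h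
  have h2 := card_connectedComponent_deleteEdges_of_isBridge h hb
  unfold cyclomaticNumber
  omega

theorem cyclomaticNumber_deleteEdges_of_not_isBridge {H : SimpleGraph V} {x y : V}
    (h : H.Adj x y) (hb : ¬ H.IsBridge s(x, y)) :
    (H.deleteEdges {s(x, y)}).cyclomaticNumber + 1 = H.cyclomaticNumber := by
  have h1 := ncard_edgeSet_deleteEdges_singleton h
  have h2 := card_connectedComponent_deleteEdges_of_not_isBridge (H := H) hb
  unfold cyclomaticNumber
  omega

theorem cyclomaticNumber_deleteEdges_le {H : SimpleGraph V} {x y : V} (h : H.Adj x y) :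
    (H.deleteEdges {s(x, y)}).cyclomaticNumber ≤ H.cyclomaticNumber := by
  by_cases hb : H.IsBridge s(x, y)
  · exact (cyclomaticNumber_deleteEdges_of_isBridge h hb).le
  · have := cyclomaticNumber_deleteEdges_of_not_isBridge h hb
    omega

theorem cyclomaticNumber_mono {H H' : SimpleGraph V} (hle : H' ≤ H) :
    H'.cyclomaticNumber ≤ H.cyclomaticNumber := by
  induction H using WellFoundedLT.induction with
  | ind H ih =>
    rcases hle.eq_or_lt with rfl | hlt
    · exact le_rfl
    · obtain ⟨x, y, h, h'⟩ := exists_adj_not_adj_of_lt hlt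
      exact (ih _ (deleteEdges_singleton_lt h) (le_deleteEdges_singleton hle h')).trans
        (cyclomaticNumber_deleteEdges_le h)

theorem cyclomaticNumber_le_of_forall_isBridge {H H' : SimpleGraph V} (hle : H' ≤ H)
    (hb : ∀ x y, H.Adj x y → ¬ H'.Adj x y → H.IsBridge s(x, y)) :
    H.cyclomaticNumber ≤ H'.cyclomaticNumber := by
  induction H using WellFoundedLT.induction with
  | ind H ih =>
    rcases hle.eq_or_lt with rfl | hlt
    · exact le_rfl
    · obtain ⟨x, y, h, h'⟩ := exists_adj_not_adj_of_lt hlt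
      rw [← cyclomaticNumber_deleteEdges_of_isBridge h (hb x y h h')]
      refine ih _ (deleteEdges_singleton_lt h) (le_deleteEdges_singleton hle h') fun u v hu hv => ?_
      exact (hb u v (deleteEdges_le _ hu) hv).anti (deleteEdges_le _)

theorem cyclomaticNumber_nonneg (H : SimpleGraph V) : 0 ≤ H.cyclomaticNumber :=
  cyclomaticNumber_bot (V := V) ▸ cyclomaticNumber_mono bot_le

/-- Deleting one edge of `C` at `x`, which is not a bridge, already lowers the number by one;
removing the other edges at `x` cannot raise it. -/
theorem IsCycleGraph.cyclomaticNumber_isolate {H C : SimpleGraph V} (hC : C.IsCycleGraph)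
    (hle : C ≤ H) {x : V} (hx : x ∈ C.support) :
    (H.isolate {x}).cyclomaticNumber + 1 ≤ H.cyclomaticNumber := by
  obtain ⟨u, hu⟩ := hx
  have hb := (not_isBridge_iff_exists_isCycleGraph (hle hu)).2 ⟨C, hle, hC, hu⟩
  rw [← cyclomaticNumber_deleteEdges_of_not_isBridge (hle hu) hb]
  gcongr
  exact cyclomaticNumber_mono (le_deleteEdges_singleton (H.isolate_le _) (fun h => h.2.1 rfl))

/-- A vertex at which two cycles of `H` diverge lowers the cyclomatic number by two. -/
theorem IsCycleGraph.cyclomaticNumber_isolate_of_adj {H C C' : SimpleGraph V}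
    (hC : C.IsCycleGraph) (hC' : C'.IsCycleGraph) (hle : C ≤ H) (hle' : C' ≤ H) {x u : V}
    (hu : C.Adj x u) (hu' : ¬ C'.Adj x u) (hx : x ∈ C'.support) :
    (H.isolate {x}).cyclomaticNumber + 2 ≤ H.cyclomaticNumber := by
  have hb := (not_isBridge_iff_exists_isCycleGraph (hle hu)).2 ⟨C, hle, hC, hu⟩
  have h1 := cyclomaticNumber_deleteEdges_of_not_isBridge (hle hu) hb
  have h2 := hC'.cyclomaticNumber_isolate (le_deleteEdges_singleton hle' hu') hx
  have h3 : (H.isolate {x}).cyclomaticNumber ≤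
      ((H.deleteEdges {s(x, u)}).isolate {x}).cyclomaticNumber := by
    apply cyclomaticNumber_mono
    intro a b hab
    refine ⟨?_, hab.2⟩
    exact le_deleteEdges_singleton (H' := H.isolate {x}) (H.isolate_le _) (fun h => h.2.1 rfl) hab
  omega

end Finite

/-- The vertices on the side of `x` after deletion of the edge `xy`. -/
def edgeSide (H : SimpleGraph V) (x y : V) : Set V :=
  {v | (H.deleteEdges {s(x, y)}).Reachable x v}

theorem mem_edgeSide_self (H : SimpleGraph V) (x y : V) : x ∈ H.edgeSide x y :=
  Reachable.refl _

theorem mem_edgeSide_of_adj {H : SimpleGraph V} {x y u v : V} (hu : u ∈ H.edgeSide x y)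
    (h : H.Adj u v) (hne : s(u, v) ≠ s(x, y)) : v ∈ H.edgeSide x y :=
  Reachable.trans hu (Adj.reachable (by rw [deleteEdges_adj]; exact ⟨h, by simpa using hne⟩))

theorem notMem_edgeSide {H : SimpleGraph V} {x y : V} (hb : H.IsBridge s(x, y)) :
    y ∉ H.edgeSide x y := hb

/-- By `hx` the vertex `x` is not on the side of `v`. A walk from `v` that avoids `uv` therefore
never reaches `x`, cannot use `xy`, and stays on the side of `x`. -/
theorem edgeSide_ssubset {H : SimpleGraph V} {x y u v : V} (hxy : H.Adj x y)
    (hu : u ∈ H.edgeSide x y) (huv : s(u, v) ≠ s(x, y)) (hadj : H.Adj u v)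
    (hx : ¬ (H.deleteEdges {s(u, v)}).Reachable x v) :
    H.edgeSide v u ⊂ H.edgeSide x y := by
  have hv : v ∈ H.edgeSide x y := mem_edgeSide_of_adj hu hadj huv
  have hsub : H.edgeSide v u ⊆ H.edgeSide x y := by
    intro z hz
    have := Reachable.mem_of_closed (S := {z | z ∈ H.edgeSide v u ∧ z ∈ H.edgeSide x y}) hz
      ⟨mem_edgeSide_self H v u, hv⟩ ?_
    · exact this.2
    · rintro a ⟨ha, ha'⟩ b hab
      refine ⟨Reachable.trans ha hab.reachable, mem_edgeSide_of_adj ha' (deleteEdges_le _ hab) ?_⟩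
      intro he
      have hxs : x ∈ H.edgeSide v u := by
        rcases Sym2.eq_iff.1 he with ⟨rfl, -⟩ | ⟨-, rfl⟩
        · exact ha
        · exact Reachable.trans ha hab.reachable
      rw [edgeSide, Sym2.eq_swap] at hxs
      exact hx (Reachable.symm hxs)
  refine ⟨hsub, fun h => hx ?_⟩
  have := h (mem_edgeSide_self H x y)
  rw [edgeSide, Sym2.eq_swap] at this
  exact this.symm

/-- Descent on the size of the side: a bridge inside it, oriented away from `x`, has a strictly
smaller side. The bridgeless side obtained is the end piece on which the later inductions operate.
-/
theorem exists_isBridge_edgeSide_minimal [Finite V] {H : SimpleGraph V} {x y : V}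
    (hxy : H.Adj x y) (hb : H.IsBridge s(x, y)) :
    ∃ x' y', H.Adj x' y' ∧ H.IsBridge s(x', y') ∧ H.edgeSide x' y' ⊆ H.edgeSide x y ∧
      ∀ u v, H.Adj u v → u ∈ H.edgeSide x' y' → v ∈ H.edgeSide x' y' → ¬ H.IsBridge s(u, v) := by
  induction hn : (H.edgeSide x y).ncard using Nat.strong_induction_on generalizing x y with
  | _ n ih =>
    subst hn
    by_cases hcon : ∀ u v, H.Adj u v → u ∈ H.edgeSide x y → v ∈ H.edgeSide x y →
        ¬ H.IsBridge s(u, v)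
    · exact ⟨x, y, hxy, hb, subset_rfl, hcon⟩
    push Not at hcon
    obtain ⟨u, v, huv, hu, hv, hbr⟩ := hcon
    have hne : s(u, v) ≠ s(x, y) := by
      intro he
      rcases Sym2.eq_iff.1 he with ⟨-, rfl⟩ | ⟨rfl, -⟩
      · exact notMem_edgeSide hb hv
      · exact notMem_edgeSide hb hu
    have step : ∀ u v, H.Adj u v → u ∈ H.edgeSide x y → s(u, v) ≠ s(x, y) →
        H.IsBridge s(u, v) → ¬ (H.deleteEdges {s(u, v)}).Reachable x v → ∃ x' y', H.Adj x' y' ∧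
        H.IsBridge s(x', y') ∧ H.edgeSide x' y' ⊆ H.edgeSide x y ∧ ∀ u v, H.Adj u v →
        u ∈ H.edgeSide x' y' → v ∈ H.edgeSide x' y' → ¬ H.IsBridge s(u, v) := by
      intro u v huv hu hne hbr hx
      have hss := edgeSide_ssubset hxy hu hne huv hx
      obtain ⟨x', y', h1, h2, h3, h4⟩ := ih _ (Set.ncard_lt_ncard hss (Set.toFinite _)) huv.symm
        (by rwa [Sym2.eq_swap]) rfl
      exact ⟨x', y', h1, h2, h3.trans hss.subset, h4⟩
    -- The bridge separates its ends, so at least one of them is cut off from `x`; its side is the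
    -- smaller one.
    by_cases hx : (H.deleteEdges {s(u, v)}).Reachable x v
    · refine step v u huv.symm hv (by rwa [Sym2.eq_swap]) (by rwa [Sym2.eq_swap]) fun hx' => ?_
      rw [Sym2.eq_swap] at hx'
      exact hbr (hx'.symm.trans hx)
    · exact step u v huv hu hne hbr hx

end SimpleGraph

/-! ### Enumerations of a cycle -/

namespace SimpleGraph

variable {V : Type*}

/-- The edges of `C` are the consecutive pairs of the closed sequence `p 0, …, p k = p 0`, whose
first `k ≥ 3` terms are distinct. -/
structure IsCycleEnum (C : SimpleGraph V) (k : ℕ) (p : ℕ → V) : Prop where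
  three_le : 3 ≤ k
  closed : p k = p 0
  injOn : Set.InjOn p (Set.Iio k)
  adj_iff : ∀ u v, C.Adj u v ↔ ∃ i < k, s(u, v) = s(p i, p (i + 1))

theorem Walk.IsCycle.isCycleEnum {G : SimpleGraph V} {v : V} {w : G.Walk v v} (hw : w.IsCycle) :
    w.toSubgraph.spanningCoe.IsCycleEnum w.length w.getVert where
  three_le := hw.three_le_length
  closed := by rw [w.getVert_length, w.getVert_zero]
  injOn := fun i hi j hj h => hw.getVert_injOn'
    (Nat.le_sub_one_of_lt hi) (Nat.le_sub_one_of_lt hj) h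
  adj_iff := fun u v => by
    rw [Subgraph.spanningCoe_adj, Walk.toSubgraph_adj_iff]
    exact ⟨fun ⟨i, h, hi⟩ => ⟨i, hi, h.symm⟩, fun ⟨i, hi, h⟩ => ⟨i, h.symm, hi⟩⟩

theorem IsCycleGraph.spanningCoe_eq {C : SimpleGraph V} {x : V} {w : C.Walk x x}
    (h : ∀ e ∈ C.edgeSet, e ∈ w.edges) : w.toSubgraph.spanningCoe = C := by
  refine le_antisymm w.toSubgraph.spanningCoe_le fun u v huv => ?_
  exact (w.mem_edges_toSubgraph).2 (h s(u, v) huv)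

theorem IsCycleGraph.exists_isCycleEnum {C : SimpleGraph V} (hC : C.IsCycleGraph) {x : V}
    (hx : x ∈ C.support) : ∃ k p, C.IsCycleEnum k p ∧ p 0 = x := by
  classical
  obtain ⟨y, w, hw, h⟩ := hC
  obtain ⟨u, hu⟩ := hx
  have hxw := w.fst_mem_support_of_mem_edges (h _ hu)
  have hw' := (Walk.isCycle_rotate hxw).2 hw
  refine ⟨(w.rotate x hxw).length, (w.rotate x hxw).getVert, ?_, (w.rotate x hxw).getVert_zero⟩
  have := hw'.isCycleEnum
  rwa [Walk.toSubgraph_rotate, IsCycleGraph.spanningCoe_eq h] at this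

theorem IsCycleGraph.support_nonempty {C : SimpleGraph V} (hC : C.IsCycleGraph) :
    C.support.Nonempty := by
  obtain ⟨y, w, hw, h⟩ := hC
  have := w.toSubgraph_adj_snd hw.not_nil
  exact ⟨y, w.snd, this.adj_sub⟩

namespace IsCycleEnum

variable {C : SimpleGraph V} {k : ℕ} {p : ℕ → V}

theorem adj (h : C.IsCycleEnum k p) {i : ℕ} (hi : i < k) : C.Adj (p i) (p (i + 1)) :=
  (h.adj_iff _ _).2 ⟨i, hi, rfl⟩

theorem mem_support_iff (h : C.IsCycleEnum k p) {v : V} : v ∈ C.support ↔ ∃ i < k, p i = v := by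
  constructor
  · rintro ⟨u, hu⟩
    obtain ⟨i, hi, he⟩ := (h.adj_iff _ _).1 hu
    rcases Sym2.eq_iff.1 he with ⟨rfl, -⟩ | ⟨rfl, -⟩
    · exact ⟨i, hi, rfl⟩
    · rcases Nat.lt_or_ge (i + 1) k with h1 | h1
      · exact ⟨i + 1, h1, rfl⟩
      · exact ⟨0, by omega, by rw [show i + 1 = k by omega, h.closed]⟩
  · rintro ⟨i, hi, rfl⟩
    exact ⟨_, h.adj hi⟩

theorem ncard_support (h : C.IsCycleEnum k p) : C.support.ncard = k := by
  have : C.support = p '' Set.Iio k := by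
    ext v
    rw [h.mem_support_iff]
    rfl
  rw [this, h.injOn.ncard_image, ← Finset.coe_range, Set.ncard_coe_finset, Finset.card_range]

theorem eq_or (h : C.IsCycleEnum k p) {i j : ℕ} (hi : i ≤ k) (hj : j ≤ k) (hij : p i = p j) :
    i = j ∨ (i = 0 ∧ j = k) ∨ (i = k ∧ j = 0) := by
  have h3 := h.three_le
  rcases hi.eq_or_lt with rfl | hi <;> rcases hj.eq_or_lt with rfl | hj
  · exact Or.inl rfl
  · rw [h.closed] at hij
    exact Or.inr (Or.inr ⟨rfl, (h.injOn (by simp; omega) hj hij).symm⟩)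
  · rw [h.closed] at hij
    exact Or.inr (Or.inl ⟨h.injOn hi (by simp; omega) hij, rfl⟩)
  · exact Or.inl (h.injOn hi hj hij)

theorem edge_injective (h : C.IsCycleEnum k p) {i j : ℕ} (hi : i < k) (hj : j < k)
    (hij : s(p i, p (i + 1)) = s(p j, p (j + 1))) : i = j := by
  have h3 := h.three_le
  rcases Sym2.eq_iff.1 hij with ⟨h1, -⟩ | ⟨h1, h2⟩
  · exact h.injOn hi hj h1
  · have h1' := h.eq_or hi.le hj h1
    have h2' := h.eq_or hi hj.le h2
    omega

/-- Take every second edge, starting at `p a`. The offset 0 gives a perfect matching of an even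
cycle; offsets 1 and 2 avoid `p 0`, respectively `p 0` and `p 1`. -/
theorem exists_isEdgeMatching (h : C.IsCycleEnum k p) {a r : ℕ} (har : a + 2 * r ≤ k) :
    ∃ M, C.IsEdgeMatching M ∧ M.card = r ∧
      ∀ e ∈ M, ∀ v ∈ e, ∃ j, a ≤ j ∧ j < a + 2 * r ∧ p j = v := by
  classical
  have key : ∀ i < r, ∀ j < r, ∀ v, v ∈ s(p (a + 2 * i), p (a + 2 * i + 1)) →
      v ∈ s(p (a + 2 * j), p (a + 2 * j + 1)) → i = j := by
    intro i hi j hj v hv hv'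
    have hinj : ∀ {m n : ℕ}, m < k → n < k → p m = p n → m = n :=
      fun hm hn hmn => h.injOn hm hn hmn
    rcases Sym2.mem_iff.1 hv with rfl | rfl <;> rcases Sym2.mem_iff.1 hv' with h1 | h1 <;>
      have := hinj (by omega) (by omega) h1 <;> omega
  refine ⟨(Finset.range r).image fun i => s(p (a + 2 * i), p (a + 2 * i + 1)), ⟨?_, ?_⟩, ?_, ?_⟩
  · intro e he
    obtain ⟨i, hi, rfl⟩ := Finset.mem_image.1 he
    rw [Finset.mem_range] at hi
    exact h.adj (by omega)
  · intro e he f hf v hve hvf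
    obtain ⟨i, hi, rfl⟩ := Finset.mem_image.1 he
    obtain ⟨j, hj, rfl⟩ := Finset.mem_image.1 hf
    rw [key i (Finset.mem_range.1 hi) j (Finset.mem_range.1 hj) v hve hvf]
  · rw [Finset.card_image_of_injOn, Finset.card_range]
    intro i hi j hj hij
    refine key i (Finset.mem_range.1 hi) j (Finset.mem_range.1 hj) _ (Sym2.mem_mk_left _ _) ?_
    rw [← show s(p (a + 2 * i), p (a + 2 * i + 1)) = s(p (a + 2 * j), p (a + 2 * j + 1)) from hij]
    exact Sym2.mem_mk_left _ _
  · intro e he v hv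
    obtain ⟨i, hi, rfl⟩ := Finset.mem_image.1 he
    rw [Finset.mem_range] at hi
    rcases Sym2.mem_iff.1 hv with rfl | rfl
    · exact ⟨_, by omega, by omega, rfl⟩
    · exact ⟨_, by omega, by omega, rfl⟩

end IsCycleEnum

end SimpleGraph

/-! ### Gain matrices of subgraphs -/

/-- A gain function with unit values on all ordered pairs of vertices. -/
structure IsUnitGain {V : Type*} (a : V → V → ℂ) : Prop where
  conj_eq : ∀ u v, a v u = star (a u v)
  norm_eq : ∀ u v, ‖a u v‖ = 1

theorem IsUnitGain.star_mul {V : Type*} {a : V → V → ℂ} (h : IsUnitGain a) (u v : V) :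
    star (a u v) * a u v = 1 := by
  rw [Complex.star_def, Complex.conj_mul', h.norm_eq]
  simp

namespace SimpleGraph

variable {V : Type*}

open Classical in
/-- The adjacency matrix of `H` weighted by `a`. -/
noncomputable def gainMatrix (a : V → V → ℂ) (H : SimpleGraph V) : Matrix V V ℂ :=
  Matrix.of fun u v => if H.Adj u v then a u v else 0

theorem gainMatrix_apply_of_adj (a : V → V → ℂ) {H : SimpleGraph V} {u v : V} (h : H.Adj u v) :
    H.gainMatrix a u v = a u v := if_pos h

theorem gainMatrix_apply_of_not_adj (a : V → V → ℂ) {H : SimpleGraph V} {u v : V}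
    (h : ¬ H.Adj u v) : H.gainMatrix a u v = 0 := if_neg h

variable {a : V → V → ℂ}

theorem gainMatrix_isHermitian (ha : IsUnitGain a) (H : SimpleGraph V) :
    (H.gainMatrix a).IsHermitian := by
  ext u v
  rw [conjTranspose_apply]
  by_cases h : H.Adj u v
  · rw [gainMatrix_apply_of_adj a h, gainMatrix_apply_of_adj a h.symm, ha.conj_eq u v, star_star]
  · rw [gainMatrix_apply_of_not_adj a h, gainMatrix_apply_of_not_adj a (fun k => h k.symm),
      star_zero]

theorem gainMatrix_sdiff_add {H C : SimpleGraph V} (hle : C ≤ H) :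
    (H \ C).gainMatrix a + C.gainMatrix a = H.gainMatrix a := by
  ext u v
  rw [Matrix.add_apply]
  by_cases hc : C.Adj u v
  · rw [gainMatrix_apply_of_adj a hc, gainMatrix_apply_of_adj a (hle hc),
      gainMatrix_apply_of_not_adj a (H := H \ C) (fun h => h.2 hc), zero_add]
  · rw [gainMatrix_apply_of_not_adj a hc, add_zero]
    by_cases h : H.Adj u v
    · rw [gainMatrix_apply_of_adj a h, gainMatrix_apply_of_adj a (H := H \ C) ⟨h, hc⟩]
    · rw [gainMatrix_apply_of_not_adj a h,
        gainMatrix_apply_of_not_adj a (H := H \ C) (fun k => h k.1)]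

variable [Fintype V]

theorem reForm_gainMatrix (H : SimpleGraph V) (f : V → ℂ) :
    (H.gainMatrix a).reForm f = (∑ u, ∑ v, star (f u) * H.gainMatrix a u v * f v).re := by
  simp only [reForm, dotProduct, mulVec, Pi.star_apply, Finset.mul_sum, mul_assoc]

/-- If `f` vanishes on a vertex cover, every term of the form is zero, so the coordinates in `K`
serve as the functionals. -/
theorem negIndex_gainMatrix_le_of_cover {H : SimpleGraph V} {K : Finset V}
    (hK : ∀ u v, H.Adj u v → u ∈ K ∨ v ∈ K) : (H.gainMatrix a).negIndex ≤ K.card := by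
  refine negIndex_le_of_ker (LinearMap.funLeft ℂ ℂ fun i => (K.equivFin.symm i : V)) ?_
  intro f hf
  have hz : ∀ v ∈ K, f v = 0 := by
    intro v hv
    have := congrFun hf (K.equivFin ⟨v, hv⟩)
    simpa [LinearMap.funLeft_apply] using this
  rw [reForm_gainMatrix, Finset.sum_eq_zero, Complex.zero_re]
  intro u _
  refine Finset.sum_eq_zero fun v _ => ?_
  by_cases h : H.Adj u v
  · rcases hK u v h with hu | hv
    · rw [hz u hu]; simp
    · rw [hz v hv]; simp
  · rw [gainMatrix_apply_of_not_adj a h]; simp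

theorem negIndex_gainMatrix_le_sdiff_add [DecidableEq V] (ha : IsUnitGain a) {H C : SimpleGraph V}
    (hle : C ≤ H) :
    (H.gainMatrix a).negIndex ≤ ((H \ C).gainMatrix a).negIndex + (C.gainMatrix a).negIndex := by
  rw [← gainMatrix_sdiff_add (a := a) hle]
  exact (gainMatrix_isHermitian ha _).negIndex_add_le (gainMatrix_isHermitian ha _)

open Classical in
/-- The projection that annihilates the coordinates in `S`. -/
noncomputable def vanishOn (S : Set V) : (V → ℂ) →ₗ[ℂ] (V → ℂ) :=
  (Matrix.diagonal fun v => if v ∈ S then (0 : ℂ) else 1).mulVecLin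

theorem vanishOn_of_mem {S : Set V} (f : V → ℂ) {v : V} (hv : v ∈ S) : vanishOn S f v = 0 := by
  simp [vanishOn, mulVec_diagonal, hv]

theorem vanishOn_of_notMem {S : Set V} (f : V → ℂ) {v : V} (hv : v ∉ S) :
    vanishOn S f v = f v := by
  simp [vanishOn, mulVec_diagonal, hv]

theorem reForm_gainMatrix_vanishOn (H : SimpleGraph V) (S : Set V) (f : V → ℂ) :
    (H.gainMatrix a).reForm (vanishOn S f) = ((H.isolate S).gainMatrix a).reForm f := by
  rw [reForm_gainMatrix, reForm_gainMatrix]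
  congr 1
  refine Finset.sum_congr rfl fun u _ => Finset.sum_congr rfl fun v _ => ?_
  by_cases hu : u ∈ S
  · rw [vanishOn_of_mem f hu, gainMatrix_apply_of_not_adj a (H := H.isolate S) fun h => h.2.1 hu]
    simp
  by_cases hv : v ∈ S
  · rw [vanishOn_of_mem f hv, gainMatrix_apply_of_not_adj a (H := H.isolate S) fun h => h.2.2 hv]
    simp
  rw [vanishOn_of_notMem f hu, vanishOn_of_notMem f hv]
  by_cases h : H.Adj u v
  · rw [gainMatrix_apply_of_adj a h, gainMatrix_apply_of_adj a (H := H.isolate S) ⟨h, hu, hv⟩]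
  · rw [gainMatrix_apply_of_not_adj a h,
      gainMatrix_apply_of_not_adj a (H := H.isolate S) fun k => h k.1]

/-- Half of Cauchy interlacing: annihilating the coordinates in `S` carries a negative definite
space of the smaller graph to one of the larger. -/
theorem negIndex_gainMatrix_isolate_le (H : SimpleGraph V) (S : Set V) :
    ((H.isolate S).gainMatrix a).negIndex ≤ (H.gainMatrix a).negIndex := by
  obtain ⟨W, hW, hneg⟩ := ((H.isolate S).gainMatrix a).exists_finrank_eq_negIndex
  rw [← hW]
  refine le_negIndex_of_linearMap ((vanishOn S).comp W.subtype) fun g hg => ?_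
  rw [LinearMap.comp_apply, reForm_gainMatrix_vanishOn]
  exact hneg g g.2 (by simpa using hg)

end SimpleGraph

/-! ### Deletion of a pendant edge -/

namespace Matrix

variable {V : Type*} [Fintype V]

theorem IsHermitian.reForm_add_vec {A : Matrix V V ℂ} (hA : A.IsHermitian) (f g : V → ℂ) :
    A.reForm (f + g) = A.reForm f + A.reForm g + 2 * (star g ⬝ᵥ A *ᵥ f).re := by
  have h : star f ⬝ᵥ A *ᵥ g = star (star g ⬝ᵥ A *ᵥ f) := by
    rw [star_dotProduct, star_mulVec, hA.eq, ← dotProduct_mulVec]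
  simp only [reForm, star_add, add_dotProduct, mulVec_add, dotProduct_add, Complex.add_re, h]
  simp
  ring

end Matrix

namespace SimpleGraph

variable {V : Type*} [Fintype V] {a : V → V → ℂ}

/-- The coordinates at `x` and `y` span a hyperbolic plane. A negative definite space of the
remaining graph is made orthogonal to this plane for the form, and a negative vector of the plane is
added. -/
theorem negIndex_gainMatrix_pendant (ha : IsUnitGain a) {H : SimpleGraph V} {x y : V}
    (hxy : H.Adj x y) (hx : ∀ z, H.Adj x z → z = y) :
    ((H.isolate {x, y}).gainMatrix a).negIndex + 1 ≤ (H.gainMatrix a).negIndex := by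
  classical
  obtain ⟨W, hW, hneg⟩ := ((H.isolate {x, y}).gainMatrix a).exists_finrank_eq_negIndex
  have hA := gainMatrix_isHermitian ha H
  set A := H.gainMatrix a with hAdef
  set P := vanishOn ({x, y} : Set V)
  have hyx : y ≠ x := hxy.ne'
  have hAx : ∀ f, (A *ᵥ f) x = a x y * f y := by
    intro f
    rw [mulVec, dotProduct, Finset.sum_eq_single y]
    · rw [hAdef, gainMatrix_apply_of_adj a hxy]
    · intro z _ hz
      rw [hAdef, gainMatrix_apply_of_not_adj a (fun h => hz (hx z h)), zero_mul]
    · simp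
  have hAyx : A y x = star (a x y) := by
    rw [hAdef, gainMatrix_apply_of_adj a hxy.symm, ha.conj_eq x y]
  -- The negative vector of the plane; the form takes the value `-2` on it.
  let z : V → ℂ := Pi.single y 1 - a x y • Pi.single x 1
  -- The coordinate at `x` is chosen to cancel `(A *ᵥ P f) y`. Then `A *ᵥ B f` vanishes at both `x`
  -- and `y`.
  let B : (V → ℂ) →ₗ[ℂ] (V → ℂ) :=
    P - (a x y • (LinearMap.proj y ∘ₗ A.mulVecLin ∘ₗ P)).smulRight (Pi.single x 1)
  let L : W × ℂ →ₗ[ℂ] (V → ℂ) :=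
    B ∘ₗ W.subtype ∘ₗ LinearMap.fst ℂ W ℂ + (LinearMap.snd ℂ W ℂ).smulRight z
  have hsingle : ∀ (u : V) (g : V → ℂ), star (Pi.single u (1 : ℂ)) ⬝ᵥ g = g u := by
    intro u g
    rw [← Pi.single_star, star_one, single_dotProduct, one_mul]
  have hBf : ∀ f, B f = P f + (-(a x y * (A *ᵥ P f) y)) • Pi.single x 1 := by
    intro f
    simp [B, sub_eq_add_neg]
  have hPx : ∀ f, P f x = 0 := fun f => vanishOn_of_mem f (by simp)
  have hPy : ∀ f, P f y = 0 := fun f => vanishOn_of_mem f (by simp)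
  have hBx : ∀ f, (A *ᵥ B f) x = 0 := by
    intro f
    rw [hAx, hBf, Pi.add_apply, hPy, Pi.smul_apply, Pi.single_eq_of_ne hyx]
    simp
  have hBy : ∀ f, (A *ᵥ B f) y = 0 := by
    intro f
    rw [hBf, mulVec_add, mulVec_smul, Pi.add_apply, Pi.smul_apply, mulVec_single_one, col_apply,
      hAyx, smul_eq_mul]
    linear_combination (-(A *ᵥ P f) y) * ha.star_mul x y
  have hqB : ∀ f, A.reForm (B f) = A.reForm (P f) := by
    intro f
    rw [hBf, hA.reForm_add_vec]
    have h1 : A.reForm ((-(a x y * (A *ᵥ P f) y)) • Pi.single x 1) = 0 := by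
      rw [reForm, star_smul, smul_dotProduct, hsingle, hAx, Pi.smul_apply, Pi.single_eq_of_ne hyx]
      simp
    have h2 : star ((-(a x y * (A *ᵥ P f) y)) • Pi.single x (1 : ℂ)) ⬝ᵥ A *ᵥ P f = 0 := by
      rw [star_smul, smul_dotProduct, hsingle, hAx, hPy]
      simp
    rw [h1, h2]
    simp
  have hzdot : ∀ (t : ℂ) (g : V → ℂ), star (t • z) ⬝ᵥ g
      = star t * (g y - star (a x y) * g x) := by
    intro t g
    rw [star_smul, smul_dotProduct, star_sub, star_smul, sub_dotProduct, smul_dotProduct, hsingle,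
      hsingle]
    rfl
  have hqz : ∀ t : ℂ, A.reForm (t • z) = -2 * ‖t‖ ^ 2 := by
    intro t
    have hzy : z y = 1 := by simp [z, hyx]
    have hAzy : (A *ᵥ z) y = -1 := by
      have hAyy : A y y = 0 := by rw [hAdef, gainMatrix_apply_of_not_adj a (H.irrefl)]
      rw [mulVec_sub, mulVec_smul, Pi.sub_apply, Pi.smul_apply, mulVec_single_one,
        mulVec_single_one, col_apply, col_apply, hAyx, hAyy, smul_eq_mul]
      linear_combination - ha.star_mul x y
    rw [reForm, hzdot, mulVec_smul, Pi.smul_apply, Pi.smul_apply, hAx, hzy, hAzy]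
    have : star t * (t • (-1 : ℂ) - star (a x y) * t • (a x y * 1)) = -2 * (star t * t) := by
      simp only [smul_eq_mul]
      linear_combination - star t * t * ha.star_mul x y
    rw [this, Complex.star_def, Complex.conj_mul']
    norm_cast
  have hq : ∀ g : W × ℂ, A.reForm (L g) =
      ((H.isolate {x, y}).gainMatrix a).reForm g.1 + -2 * ‖g.2‖ ^ 2 := by
    intro g
    have : L g = B g.1 + g.2 • z := rfl
    rw [this, hA.reForm_add_vec, hzdot, hBx, hBy, hqB, hqz, hAdef, reForm_gainMatrix_vanishOn]
    simp
  have hfin : Module.finrank ℂ (W × ℂ) = ((H.isolate {x, y}).gainMatrix a).negIndex + 1 := by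
    rw [Module.finrank_prod, hW, Module.finrank_self]
  rw [← hfin]
  refine le_negIndex_of_linearMap L fun g hg => ?_
  rw [hq]
  by_cases h1 : g.1 = 0
  · have h2 : g.2 ≠ 0 := fun h2 => hg (Prod.ext h1 h2)
    have : 0 < ‖g.2‖ := norm_pos_iff.2 h2
    rw [h1, Submodule.coe_zero, reForm_zero]
    nlinarith
  · have := hneg g.1 g.1.2 (by simpa using h1)
    nlinarith [sq_nonneg ‖g.2‖]

end SimpleGraph

/-! ### Negative index of an even cycle -/

namespace SimpleGraph

variable {V : Type*} [Fintype V] {a : V → V → ℂ}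

theorem sum_ite_sym2_eq {x y : V} (hxy : x ≠ y) [DecidableEq V] (F : V → V → ℂ) :
    ∑ u, ∑ v, (if s(u, v) = s(x, y) then F u v else 0) = F x y + F y x := by
  have h : ∀ u v, (if s(u, v) = s(x, y) then F u v else 0) =
      (if u = x then if v = y then F u v else 0 else 0) +
        (if u = y then if v = x then F u v else 0 else 0) := by
    intro u v
    simp only [Sym2.eq_iff]
    by_cases h1 : u = x
    · subst h1
      by_cases h2 : v = y
      · subst h2
        simp [hxy]
      · simp [hxy, h2]
    · by_cases h2 : u = y
      · subst h2
        simp [h1]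
      · simp [h1, h2]
  simp only [h, Finset.sum_add_distrib]
  simp

namespace IsCycleEnum

variable {C : SimpleGraph V} {k : ℕ} {p : ℕ → V}

theorem reForm_gainMatrix_eq_sum (h : C.IsCycleEnum k p) (ha : IsUnitGain a) (f : V → ℂ) :
    (C.gainMatrix a).reForm f =
      ∑ i ∈ Finset.range k, 2 * (star (f (p i)) * a (p i) (p (i + 1)) * f (p (i + 1))).re := by
  classical
  have hentry : ∀ u v, star (f u) * C.gainMatrix a u v * f v =
      ∑ i ∈ Finset.range k, if s(u, v) = s(p i, p (i + 1)) then star (f u) * a u v * f v else 0 := by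
    intro u v
    by_cases huv : C.Adj u v
    · obtain ⟨i, hi, he⟩ := (h.adj_iff u v).1 huv
      rw [Finset.sum_eq_single i, if_pos he, gainMatrix_apply_of_adj a huv]
      · intro j hj hji
        rw [if_neg]
        intro he'
        exact hji (h.edge_injective (Finset.mem_range.1 hj) hi (he'.symm.trans he))
      · intro hn
        exact absurd (Finset.mem_range.2 hi) hn
    · rw [gainMatrix_apply_of_not_adj a huv, mul_zero, zero_mul, Finset.sum_eq_zero]
      intro i hi
      rw [if_neg]
      exact fun he => huv ((h.adj_iff u v).2 ⟨i, Finset.mem_range.1 hi, he⟩)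
  rw [reForm_gainMatrix]
  simp only [hentry]
  have hcomm : ∑ u, ∑ v, ∑ i ∈ Finset.range k,
      (if s(u, v) = s(p i, p (i + 1)) then star (f u) * a u v * f v else 0) =
      ∑ i ∈ Finset.range k, ∑ u, ∑ v,
        (if s(u, v) = s(p i, p (i + 1)) then star (f u) * a u v * f v else 0) :=
    (Finset.sum_congr rfl fun u _ => Finset.sum_comm).trans Finset.sum_comm
  rw [hcomm, Complex.re_sum]
  refine Finset.sum_congr rfl fun i hi => ?_
  rw [sum_ite_sym2_eq (h.adj (Finset.mem_range.1 hi)).ne (fun u v => star (f u) * a u v * f v),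
    ha.conj_eq (p i)]
  have : star (f (p (i + 1))) * star (a (p i) (p (i + 1))) * f (p i) =
      star (star (f (p i)) * a (p i) (p (i + 1)) * f (p (i + 1))) := by
    simp only [star_mul', star_star]
    ring
  rw [this, Complex.add_re, Complex.star_def, Complex.conj_re]
  ring

end IsCycleEnum

/-- The value at `p (2 j + 1)` of the gain matrix of a cycle applied to `f`. -/
def oddRow (a : V → V → ℂ) (p : ℕ → V) (f : V → ℂ) (j : ℕ) : ℂ :=
  a (p (2 * j + 1)) (p (2 * j)) * f (p (2 * j)) +
    a (p (2 * j + 1)) (p (2 * j + 2)) * f (p (2 * j + 2))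

theorem _root_.Finset.sum_range_two_mul (r : ℕ) (g : ℕ → ℝ) :
    ∑ i ∈ Finset.range (2 * r), g i = ∑ j ∈ Finset.range r, (g (2 * j) + g (2 * j + 1)) := by
  induction r with
  | zero => simp
  | succ r ih =>
    rw [show 2 * (r + 1) = 2 * r + 1 + 1 by ring, Finset.sum_range_succ, Finset.sum_range_succ, ih,
      Finset.sum_range_succ]
    ring

/-- Each edge of an even cycle has exactly one end of odd index. Grouping edges by that end pairs
the values of `f` at odd vertices with functionals of its values at even ones. -/
theorem IsCycleEnum.reForm_gainMatrix_eq_oddRow {C : SimpleGraph V} {r : ℕ} {p : ℕ → V}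
    (h : C.IsCycleEnum (2 * r) p) (ha : IsUnitGain a) (f : V → ℂ) :
    (C.gainMatrix a).reForm f =
      ∑ j ∈ Finset.range r, 2 * (star (f (p (2 * j + 1))) * oddRow a p f j).re := by
  rw [h.reForm_gainMatrix_eq_sum ha, Finset.sum_range_two_mul]
  refine Finset.sum_congr rfl fun j _ => ?_
  have h1 : star (f (p (2 * j + 1))) * (a (p (2 * j + 1)) (p (2 * j)) * f (p (2 * j))) =
      star (star (f (p (2 * j))) * a (p (2 * j)) (p (2 * j + 1)) * f (p (2 * j + 1))) := by
    rw [ha.conj_eq (p (2 * j))]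
    simp only [star_mul', star_star]
    ring
  rw [oddRow, mul_add, h1, Complex.add_re, Complex.star_def, Complex.conj_re, ← mul_assoc]
  ring

omit [Fintype V] in
-- A vanishing row determines `f` at one even vertex from the preceding one, with a factor `-1` and
-- two conjugated gains.
theorem eq_of_oddRow_eq_zero (ha : IsUnitGain a) {p : ℕ → V} {f : V → ℂ} {m : ℕ}
    (h : ∀ j < m, oddRow a p f j = 0) :
    f (p (2 * m)) = (-1) ^ m * star (∏ i ∈ Finset.range (2 * m), a (p i) (p (i + 1))) * f (p 0) := by
  induction m with
  | zero => simp
  | succ m ih =>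
    have h1 := ih fun j hj => h j (by omega)
    have h2 := h m (by omega)
    rw [oddRow, ha.conj_eq (p (2 * m)), h1] at h2
    rw [show 2 * (m + 1) = 2 * m + 1 + 1 by ring, Finset.prod_range_succ, Finset.prod_range_succ,
      star_mul', star_mul', show 2 * m + 1 + 1 = 2 * m + 2 by ring]
    have h3 := ha.star_mul (p (2 * m + 1)) (p (2 * m + 2))
    linear_combination star (a (p (2 * m + 1)) (p (2 * m + 2))) * h2
      - f (p (2 * m + 2)) * h3

omit [Fintype V] in
theorem norm_prod_gain (ha : IsUnitGain a) (p : ℕ → V) (k : ℕ) :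
    ‖∏ i ∈ Finset.range k, a (p i) (p (i + 1))‖ = 1 := by
  rw [norm_prod]
  exact Finset.prod_eq_one fun i _ => ha.norm_eq _ _

/-- If all rows but the last vanish, propagation around the cycle closes up because the gain is
`(-1) ^ r`, so the last row vanishes too. The form is thus zero on the kernel of `r - 1`
functionals. -/
theorem IsCycleEnum.negIndex_add_one_le {C : SimpleGraph V} {r : ℕ} {p : ℕ → V}
    (h : C.IsCycleEnum (2 * r) p) (ha : IsUnitGain a)
    (hgain : ∏ i ∈ Finset.range (2 * r), a (p i) (p (i + 1)) = (-1) ^ r) :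
    (C.gainMatrix a).negIndex + 1 ≤ r := by
  have h3 := h.three_le
  obtain ⟨m, rfl⟩ : ∃ m, r = m + 1 := ⟨r - 1, by omega⟩
  let L : (V → ℂ) →ₗ[ℂ] (Fin m → ℂ) :=
    { toFun := fun f j => oddRow a p f j
      map_add' := fun f g => by
        ext j
        simp only [oddRow, Pi.add_apply]
        ring
      map_smul' := fun c f => by
        ext j
        simp only [oddRow, Pi.smul_apply, smul_eq_mul, RingHom.id_apply]
        ring }
  have := negIndex_le_of_ker (A := C.gainMatrix a) L ?_
  · omega
  intro f hf
  have hrow : ∀ j < m, oddRow a p f j = 0 := fun j hj => congrFun hf ⟨j, hj⟩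
  have hlast : oddRow a p f m = 0 := by
    have h1 := eq_of_oddRow_eq_zero ha hrow
    rw [show 2 * (m + 1) = 2 * m + 1 + 1 by ring, Finset.prod_range_succ,
      Finset.prod_range_succ] at hgain
    have hcl : p (2 * m + 2) = p 0 := h.closed
    have h4 := congrArg star hgain
    rw [star_mul', star_mul', star_pow, star_neg, star_one] at h4
    have h5 := ha.star_mul (p (2 * m + 1)) (p (2 * m + 2))
    have h6 : ((-1 : ℂ) ^ m) * (-1) ^ m = 1 := by rw [← mul_pow]; simp
    have hne : star (a (p (2 * m + 1)) (p (2 * m + 2))) ≠ 0 := by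
      intro h0
      rw [h0, zero_mul] at h5
      exact zero_ne_one h5
    apply (mul_eq_zero.1 _).resolve_left hne
    rw [oddRow, h1, ha.conj_eq (p (2 * m))]
    rw [show 2 * m + 1 + 1 = 2 * m + 2 by ring] at h4
    rw [hcl] at h4 h5 ⊢
    rw [pow_succ] at h4
    linear_combination (-1) ^ m * f (p 0) * h4 + f (p 0) * h5 - f (p 0) * h6
  rw [h.reForm_gainMatrix_eq_oddRow ha]
  refine (Finset.sum_eq_zero fun j hj => ?_).ge
  have : oddRow a p f j = 0 := by
    rcases (Nat.lt_succ_iff.1 (Finset.mem_range.1 hj)).lt_or_eq with hj | rfl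
    · exact hrow j hj
    · exact hlast
  simp [this]

/-- With free values at the even vertices and minus the row at each odd vertex, the form is `-2`
times the sum of the squared row norms. If all rows vanished, one turn around the cycle would
multiply the value at `p 0` by a number other than 1, forcing it and all other even values to be
zero. -/
theorem IsCycleEnum.le_negIndex {C : SimpleGraph V} {r : ℕ} {p : ℕ → V}
    (h : C.IsCycleEnum (2 * r) p) (ha : IsUnitGain a)
    (hgain : ∏ i ∈ Finset.range (2 * r), a (p i) (p (i + 1)) ≠ (-1) ^ r) :
    r ≤ (C.gainMatrix a).negIndex := by
  classical
  let E : (Fin r → ℂ) →ₗ[ℂ] (V → ℂ) :=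
    ∑ j : Fin r, (LinearMap.proj j).smulRight (Pi.single (p (2 * j)) (1 : ℂ))
  let R : Fin r → (V → ℂ) →ₗ[ℂ] ℂ := fun j =>
    a (p (2 * j + 1)) (p (2 * j)) • LinearMap.proj (p (2 * j)) +
      a (p (2 * j + 1)) (p (2 * j + 2)) • LinearMap.proj (p (2 * j + 2))
  have hR : ∀ j f, R j f = oddRow a p f j := fun j f => rfl
  let L : (Fin r → ℂ) →ₗ[ℂ] (V → ℂ) :=
    E - ∑ j : Fin r, (R j ∘ₗ E).smulRight (Pi.single (p (2 * j + 1)) (1 : ℂ))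
  have hsingle : ∀ i < 2 * r, ∀ j < 2 * r, (Pi.single (p i) (1 : ℂ) : V → ℂ) (p j) =
      if i = j then 1 else 0 := by
    intro i hi j hj
    rw [Pi.single_apply]
    refine if_congr ⟨fun he => (h.injOn hj hi he).symm, fun he => by rw [he]⟩ rfl rfl
  have hE : ∀ g f, f = E g → (∀ i : Fin r, f (p (2 * i)) = g i) ∧ ∀ i < r, f (p (2 * i + 1)) = 0 := by
    rintro g f rfl
    constructor
    · intro i
      simp only [E, LinearMap.sum_apply, LinearMap.smulRight_apply, LinearMap.proj_apply,
        Finset.sum_apply, Pi.smul_apply]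
      rw [Finset.sum_eq_single i]
      · rw [hsingle _ (by omega) _ (by omega), if_pos rfl, smul_eq_mul, mul_one]
      · intro j _ hji
        rw [hsingle _ (by omega) _ (by omega), if_neg (by omega), smul_zero]
      · simp
    · intro i hi
      simp only [E, LinearMap.sum_apply, LinearMap.smulRight_apply, LinearMap.proj_apply,
        Finset.sum_apply, Pi.smul_apply]
      refine Finset.sum_eq_zero fun j _ => ?_
      rw [hsingle _ (by omega) _ (by omega), if_neg (by omega), smul_zero]
  have hLE : ∀ g, ∀ i < r, L g (p (2 * i)) = E g (p (2 * i)) := by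
    intro g i hi
    simp only [L, LinearMap.sub_apply, LinearMap.sum_apply, LinearMap.smulRight_apply,
      Pi.sub_apply, Finset.sum_apply, Pi.smul_apply]
    rw [Finset.sum_eq_zero, sub_zero]
    intro j _
    rw [hsingle _ (by omega) _ (by omega), if_neg (by omega), smul_zero]
  -- The last row refers to `p (2 * r)`, which is `p 0`.
  have hLE' : ∀ g, ∀ i ≤ r, L g (p (2 * i)) = E g (p (2 * i)) := by
    intro g i hi
    rcases hi.lt_or_eq with hi | rfl
    · exact hLE g i hi
    · have h3 := h.three_le
      rw [h.closed]
      exact hLE g 0 (by omega)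
  have hrow : ∀ g, ∀ i < r, oddRow a p (L g) i = oddRow a p (E g) i := by
    intro g i hi
    rw [oddRow, oddRow, show 2 * i + 2 = 2 * (i + 1) by ring, hLE' g i hi.le, hLE' g (i + 1) hi]
  have hodd : ∀ g (i : Fin r), L g (p (2 * i + 1)) = - oddRow a p (L g) i := by
    intro g i
    rw [hrow g i i.2]
    simp only [L, LinearMap.sub_apply, LinearMap.sum_apply, LinearMap.smulRight_apply,
      Pi.sub_apply, Finset.sum_apply, Pi.smul_apply, LinearMap.comp_apply, hR]
    rw [(hE g _ rfl).2 i i.2, Finset.sum_eq_single i]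
    · rw [hsingle _ (by omega) _ (by omega), if_pos rfl, smul_eq_mul, mul_one, zero_sub]
    · intro j _ hji
      rw [hsingle _ (by omega) _ (by omega), if_neg (by omega), smul_zero]
    · simp
  have hfin : Module.finrank ℂ (Fin r → ℂ) = r := by simp
  conv_lhs => rw [← hfin]
  refine le_negIndex_of_linearMap L fun g hg => ?_
  have hform : (C.gainMatrix a).reForm (L g) =
      ∑ j ∈ Finset.range r, -2 * ‖oddRow a p (L g) j‖ ^ 2 := by
    rw [h.reForm_gainMatrix_eq_oddRow ha]
    refine Finset.sum_congr rfl fun j hj => ?_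
    rw [hodd g ⟨j, Finset.mem_range.1 hj⟩, star_neg, neg_mul, Complex.star_def, Complex.conj_mul',
      Complex.neg_re, ← Complex.ofReal_pow, Complex.ofReal_re]
    ring
  rw [hform]
  have hex : ∃ j ∈ Finset.range r, oddRow a p (L g) j ≠ 0 := by
    by_contra hcon
    push Not at hcon
    have hz : ∀ j < r, oddRow a p (L g) j = 0 := fun j hj => hcon j (Finset.mem_range.2 hj)
    have h0 := eq_of_oddRow_eq_zero ha hz
    rw [h.closed] at h0
    have hp0 : L g (p 0) = 0 := by
      by_contra hne
      have h1 : (-1) ^ r * star (∏ i ∈ Finset.range (2 * r), a (p i) (p (i + 1))) = 1 := by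
        apply mul_right_cancel₀ hne
        rw [one_mul]
        exact h0.symm
      have h2 := norm_prod_gain ha p (2 * r)
      have h3 := Complex.conj_mul' (∏ i ∈ Finset.range (2 * r), a (p i) (p (i + 1)))
      rw [h2, ← Complex.star_def] at h3
      apply hgain
      have h6 : ((-1 : ℂ) ^ r) * (-1) ^ r = 1 := by rw [← mul_pow]; simp
      push_cast at h3
      set π := ∏ i ∈ Finset.range (2 * r), a (p i) (p (i + 1))
      linear_combination (-1) ^ r * h3 - π * h1
    apply hg
    ext i
    rw [Pi.zero_apply, ← (hE g _ rfl).1 i, ← hLE g i i.2,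
      eq_of_oddRow_eq_zero ha (fun j hj => hz j (hj.trans i.2)), hp0, mul_zero]
  obtain ⟨j, hj, hne⟩ := hex
  refine Finset.sum_neg' (fun i _ => ?_) ⟨j, hj, ?_⟩
  · nlinarith [sq_nonneg ‖oddRow a p (L g) i‖]
  · have : 0 < ‖oddRow a p (L g) j‖ := norm_pos_iff.2 hne
    nlinarith

end SimpleGraph

/-! ### The lower bound and tight graphs -/

namespace SimpleGraph

variable {V : Type*}

/-- An edge at `x` other than `xy` lies inside the side of `x`, where there are no bridges. -/
theorem eq_of_adj_of_edgeSide_minimal {H : SimpleGraph V} {x y : V}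
    (hmin : ∀ u v, H.Adj u v → u ∈ H.edgeSide x y → v ∈ H.edgeSide x y → ¬ H.IsBridge s(u, v))
    (hbr : ∀ z, H.Adj x z → H.IsBridge s(x, z)) : ∀ z, H.Adj x z → z = y := by
  intro z hz
  by_contra hne
  refine hmin x z hz (mem_edgeSide_self H x y) ?_ (hbr z hz)
  exact mem_edgeSide_of_adj (mem_edgeSide_self H x y) hz (fun he => hne (Sym2.congr_right.1 he))

theorem matchingNumber_le_isolate_pendant [Finite V] {H : SimpleGraph V} {x y : V}
    (hx : ∀ z, H.Adj x z → z = y) :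
    H.matchingNumber ≤ (H.isolate {x, y}).matchingNumber + 1 := by
  have := matchingNumber_le_isolate_add (G := H) (S := {x, y}) (K := {y}) ?_
  · simpa using this
  · rintro u v huv (rfl | rfl)
    · exact Or.inr (by simp [hx v huv])
    · exact Or.inl (by simp)

theorem matchingNumber_isolate_pair_add_one_le [Finite V] {H : SimpleGraph V} {x y : V}
    (hxy : H.Adj x y) : (H.isolate {x, y}).matchingNumber + 1 ≤ H.matchingNumber := by
  classical
  obtain ⟨M, hM, hc⟩ := (H.isolate {x, y}).exists_isEdgeMatching
  have hs : H.IsEdgeMatching {s(x, y)} := by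
    refine ⟨fun e he => ?_, fun e he f hf _ _ _ => ?_⟩
    · rw [Finset.mem_singleton.1 he]
      exact hxy
    · rw [Finset.mem_singleton.1 he, Finset.mem_singleton.1 hf]
  have hdis : ∀ e ∈ M, ∀ f ∈ ({s(x, y)} : Finset (Sym2 V)), ∀ v, v ∈ e → v ∉ f := by
    intro e he f hf v hv hvf
    rw [Finset.mem_singleton.1 hf] at hvf
    exact (mem_edgeSet_isolate.1 (hM.1 e he)).2 v hv (by simpa using hvf)
  have h1 := ((hM.mono (H.isolate_le _)).union hs hdis).card_le
  rw [card_union_of_no_common_vertex hdis, hc, Finset.card_singleton] at h1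
  exact h1

variable [Fintype V] {a : V → V → ℂ}

theorem matchingNumber_le_negIndex_add_cyclomaticNumber (ha : IsUnitGain a) (H : SimpleGraph V) :
    (H.matchingNumber : ℤ) ≤ (H.gainMatrix a).negIndex + H.cyclomaticNumber := by
  induction H using WellFoundedLT.induction with
  | ind H ih =>
    by_cases hcyc : ∃ C ≤ H, C.IsCycleGraph
    · obtain ⟨C, hle, hC⟩ := hcyc
      obtain ⟨x, hx⟩ := hC.support_nonempty
      obtain ⟨u, hu⟩ := id hx
      have h1 := ih _ (isolate_lt (hle hu) (Set.mem_singleton x))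
      have h2 := H.matchingNumber_le_isolate_singleton x
      have h3 := negIndex_gainMatrix_isolate_le (a := a) H {x}
      have h4 := hC.cyclomaticNumber_isolate hle hx
      omega
    push Not at hcyc
    have hbr : ∀ u v, H.Adj u v → H.IsBridge s(u, v) := by
      intro u v huv
      by_contra hn
      obtain ⟨C, hle, hC, -⟩ := (not_isBridge_iff_exists_isCycleGraph huv).1 hn
      exact hcyc C hle hC
    by_cases hbot : H = ⊥
    · rw [hbot, matchingNumber_bot, cyclomaticNumber_bot]
      positivity
    obtain ⟨x, y, hxy, -⟩ := exists_adj_not_adj_of_lt (bot_lt_iff_ne_bot.2 hbot)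
    obtain ⟨x, y, hxy, -, -, hmin⟩ := exists_isBridge_edgeSide_minimal hxy (hbr x y hxy)
    have hx := eq_of_adj_of_edgeSide_minimal hmin (hbr x)
    have h1 := ih _ (isolate_lt (S := {x, y}) hxy (by simp))
    have h2 := matchingNumber_le_isolate_pendant hx
    have h3 := negIndex_gainMatrix_pendant ha hxy hx
    have h4 := cyclomaticNumber_mono (H.isolate_le {x, y})
    omega

/-- The negative index attains its lower bound `m(H) - c(H)`. -/
def IsTight (a : V → V → ℂ) (H : SimpleGraph V) : Prop :=
  ((H.gainMatrix a).negIndex : ℤ) + H.cyclomaticNumber ≤ H.matchingNumber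

namespace IsTight

variable {H : SimpleGraph V}

/-- The lower bound for the smaller graph leaves no slack in the three estimates used for this
deletion. -/
theorem isolate_singleton (ha : IsUnitGain a) (h : H.IsTight a) {C : SimpleGraph V} (hle : C ≤ H)
    (hC : C.IsCycleGraph) {x : V} (hx : x ∈ C.support) :
    (H.isolate {x}).IsTight a ∧ (H.isolate {x}).matchingNumber + 1 = H.matchingNumber ∧
      (H.isolate {x}).cyclomaticNumber + 1 = H.cyclomaticNumber := by
  have h1 := matchingNumber_le_negIndex_add_cyclomaticNumber ha (H.isolate {x})
  have h2 := H.matchingNumber_le_isolate_singleton x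
  have h3 := negIndex_gainMatrix_isolate_le (a := a) H {x}
  have h4 := hC.cyclomaticNumber_isolate hle hx
  unfold IsTight at h ⊢
  omega

/-- Tightness forbids a drop of the cyclomatic number, which keeps `y` off the cycles; `x` has
degree one. -/
theorem isolate_pendant (ha : IsUnitGain a) (h : H.IsTight a) {x y : V} (hxy : H.Adj x y)
    (hx : ∀ z, H.Adj x z → z = y) :
    (H.isolate {x, y}).IsTight a ∧
      ∀ C ≤ H, C.IsCycleGraph → Disjoint C.support {x, y} := by
  have h1 := matchingNumber_le_negIndex_add_cyclomaticNumber ha (H.isolate {x, y})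
  have h2 := matchingNumber_le_isolate_pendant hx
  have h3 := negIndex_gainMatrix_pendant ha hxy hx
  have h4 := cyclomaticNumber_mono (H.isolate_le {x, y})
  unfold IsTight at h ⊢
  refine ⟨by omega, fun C hle hC => ?_⟩
  have hy : y ∉ C.support := by
    intro hy
    have h5 := hC.cyclomaticNumber_isolate hle hy
    have h6 : (H.isolate {x, y}).cyclomaticNumber ≤ (H.isolate {y}).cyclomaticNumber := by
      apply cyclomaticNumber_mono
      intro u v huv
      exact ⟨huv.1, fun hu => huv.2.1 (Or.inr hu), fun hv => huv.2.2 (Or.inr hv)⟩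
    omega
  rw [Set.disjoint_right]
  rintro v (rfl | rfl)
  · rintro ⟨z, hz⟩
    obtain rfl := hx z (hle hz)
    exact hy ⟨_, hz.symm⟩
  · exact hy

/-- Deleting a common vertex where two cycles diverge lowers the cyclomatic number by two, while
tightness allows only one. -/
theorem disjointCycles (ha : IsUnitGain a) (h : H.IsTight a) : H.DisjointCycles := by
  intro C hle C' hle' hC hC' v hv hv'
  have key : ∀ {C C' : SimpleGraph V}, C ≤ H → C' ≤ H → C.IsCycleGraph → C'.IsCycleGraph →
      ∀ v ∈ C'.support, ∀ u, C.Adj v u → C'.Adj v u := by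
    intro C C' hle hle' hC hC' v hv u huv
    by_contra hn
    have h1 := hC.cyclomaticNumber_isolate_of_adj hC' hle hle' huv hn hv
    have h2 := (h.isolate_singleton ha hle' hC' hv).2.2
    omega
  exact hC.eq_of_forall_adj_iff hC' hv hv' fun w hw hw' u =>
    ⟨key hle hle' hC hC' w hw' u, key hle' hle hC' hC w hw u⟩

end IsTight

theorem IsCycleEnum.two_mul_matchingNumber_le {C : SimpleGraph V} {k : ℕ} {p : ℕ → V}
    (h : C.IsCycleEnum k p) : 2 * C.matchingNumber ≤ k := by
  classical
  obtain ⟨M, hM, hc⟩ := C.exists_isEdgeMatching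
  rw [← hc, ← h.ncard_support, Set.ncard_eq_toFinset_card']
  refine hM.two_mul_card_le fun e he v hv => ?_
  obtain ⟨u, rfl⟩ := Sym2.mem_iff_exists.1 hv
  rw [Set.mem_toFinset]
  exact ⟨u, hM.1 _ he⟩

/-- The cycles of a tight gain graph are even, with gain `(-1) ^ (k / 2)`. -/
theorem IsTight.isCycleEnum_gain (ha : IsUnitGain a) {H C : SimpleGraph V} (h : H.IsTight a)
    (hle : C ≤ H) (hC : C.IsCycleGraph) {k : ℕ} {p : ℕ → V} (hp : C.IsCycleEnum k p) :
    Even k ∧ ∏ i ∈ Finset.range k, a (p i) (p (i + 1)) = (-1) ^ (k / 2) := by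
  induction H using WellFoundedLT.induction with
  | ind H ih =>
    have hD := h.disjointCycles ha
    by_cases hother : ∃ C' ≤ H, C'.IsCycleGraph ∧ C' ≠ C
    · obtain ⟨C', hle', hC', hne⟩ := hother
      obtain ⟨x, hx⟩ := hC'.support_nonempty
      obtain ⟨u, hu⟩ := id hx
      refine ih _ (isolate_lt (hle' hu) (Set.mem_singleton x))
        (h.isolate_singleton ha hle' hC' hx).1 (le_isolate_iff.2 ⟨hle, ?_⟩)
      rw [Set.disjoint_singleton_right]
      exact fun hxC => hne (hD C' hle' C hle hC' hC x hx hxC)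
    push Not at hother
    have hp0 : p 0 ∈ C.support := hp.mem_support_iff.2 ⟨0, by have := hp.three_le; omega, rfl⟩
    rcases hle.eq_or_lt with rfl | hlt
    · obtain ⟨h1, h2, h3⟩ := h.isolate_singleton ha le_rfl hC hp0
      have h4 := cyclomaticNumber_nonneg (C.isolate {p 0})
      have h5 := hp.two_mul_matchingNumber_le
      obtain ⟨r, rfl | rfl⟩ := Nat.even_or_odd' k
      · refine ⟨even_two_mul r, ?_⟩
        rw [Nat.mul_div_cancel_left r two_pos]
        by_contra hn
        -- Here `n ≥ r`, `c ≥ 1` and `m ≤ r`, against tightness.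
        have h6 := hp.le_negIndex ha hn
        unfold IsTight at h
        omega
      -- Odd length: the path left by deleting `p 0` still has a matching of `r` edges, so the
      -- matching number cannot drop as `h2` demands.
      · obtain ⟨M, hM, hc, hv⟩ := hp.exists_isEdgeMatching (a := 1) (r := r) (by omega)
        have hM' : (C.isolate {p 0}).IsEdgeMatching M := by
          refine ⟨fun e he => mem_edgeSet_isolate.2 ⟨hM.1 e he, fun v hve hv0 => ?_⟩, hM.2⟩
          obtain ⟨j, hj, hj', rfl⟩ := hv e he v hve
          have := hp.injOn (show j < _ by omega) (show 0 < _ by omega) hv0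
          omega
        have := hM'.card_le
        omega
    · obtain ⟨x, y, hxy, hxy'⟩ := exists_adj_not_adj_of_lt hlt
      have hon : ∀ u v, H.Adj u v → ¬ C.Adj u v → H.IsBridge s(u, v) := by
        intro u v huv huv'
        by_contra hn
        obtain ⟨C', hle', hC', hadj⟩ := (not_isBridge_iff_exists_isCycleGraph huv).1 hn
        rw [hother C' hle' hC'] at hadj
        exact huv' hadj
      -- On the side of a bridge that misses `C`, an innermost bridge ends in a vertex off `C`. All
      -- its edges are bridges, so it is a leaf, and deleting it with its neighbour keeps `C`.
      have main : ∀ x y, H.Adj x y → ¬ C.Adj x y → p 0 ∉ H.edgeSide x y →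
          Even k ∧ ∏ i ∈ Finset.range k, a (p i) (p (i + 1)) = (-1) ^ (k / 2) := by
        intro x y hxy hxy' hside
        obtain ⟨x', y', hadj, -, hsub, hmin⟩ :=
          exists_isBridge_edgeSide_minimal hxy (hon x y hxy hxy')
        have hnot : x' ∉ C.support := by
          intro hx'
          have h1 := (hC.reachable hx' hp0).mono (le_deleteEdges_singleton hle hxy')
          exact hside (Reachable.trans (hsub (mem_edgeSide_self H x' y')) h1)
        have hx' := eq_of_adj_of_edgeSide_minimal hmin
          fun z hz => hon x' z hz fun hz' => hnot ⟨z, hz'⟩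
        obtain ⟨ht, hdis⟩ := h.isolate_pendant ha hadj hx'
        exact ih _ (isolate_lt hadj (by simp)) ht (le_isolate_iff.2 ⟨hle, hdis C hle hC⟩)
      by_cases hside : p 0 ∈ H.edgeSide x y
      · refine main y x hxy.symm (fun h => hxy' h.symm) fun hside' => ?_
        rw [edgeSide, Sym2.eq_swap] at hside'
        exact hon x y hxy hxy' (Reachable.trans hside (Reachable.symm hside'))
      · exact main x y hxy hxy' hside

end SimpleGraph

/-! ### Splitting off disjoint cycles: matchings and the upper bound -/

namespace SimpleGraph

variable {V : Type*} {H C : SimpleGraph V}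

theorem IsCycleGraph.support_subset_cycleVertices (hC : C.IsCycleGraph) (hle : C ≤ H) :
    C.support ⊆ H.cycleVertices := fun _ hv => mem_cycleVertices_iff.2 ⟨C, hle, hC, hv⟩

theorem mem_cycleVertices_of_not_isBridge {u v : V} (h : H.Adj u v) (hb : ¬ H.IsBridge s(u, v)) :
    u ∈ H.cycleVertices ∧ v ∈ H.cycleVertices := by
  obtain ⟨C, hle, hC, huv⟩ := (not_isBridge_iff_exists_isCycleGraph h).1 hb
  exact ⟨hC.support_subset_cycleVertices hle ⟨v, huv⟩,
    hC.support_subset_cycleVertices hle ⟨u, huv.symm⟩⟩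

namespace DisjointCycles

theorem le_sdiff_iff (hD : H.DisjointCycles) (hle : C ≤ H) (hC : C.IsCycleGraph)
    {C' : SimpleGraph V} (hC' : C'.IsCycleGraph) (hle' : C' ≤ H) :
    C' ≤ H \ C ↔ Disjoint C'.support C.support := by
  constructor
  · intro h
    rw [Set.disjoint_left]
    intro v hv hv'
    have heq := hD C' hle' C hle hC' hC v hv hv'
    obtain ⟨u, hu⟩ := hv
    exact (h hu).2 (heq ▸ hu)
  · intro h u v huv
    exact ⟨hle' huv, fun hc => Set.disjoint_left.1 h ⟨v, huv⟩ ⟨v, hc⟩⟩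

/-- A cycle of `H` through an edge outside `C` is different from `C`, hence disjoint from it, and
survives in `H \ C`. -/
theorem sdiff_isBridge (hD : H.DisjointCycles) (hle : C ≤ H) (hC : C.IsCycleGraph) {u v : V}
    (huv : (H \ C).Adj u v) (hb : (H \ C).IsBridge s(u, v)) : H.IsBridge s(u, v) := by
  by_contra hn
  obtain ⟨C', hle', hC', hadj⟩ := (not_isBridge_iff_exists_isCycleGraph huv.1).1 hn
  refine hC'.not_isBridge hadj (hb.anti ((hD.le_sdiff_iff hle hC hC' hle').2 ?_))
  rw [Set.disjoint_left]
  intro w hw hw'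
  rw [hD C' hle' C hle hC' hC w hw hw'] at hadj
  exact huv.2 hadj

theorem cycleVertices_sdiff (hD : H.DisjointCycles) (hle : C ≤ H) (hC : C.IsCycleGraph) :
    (H \ C).cycleVertices = H.cycleVertices \ C.support := by
  ext v
  rw [Set.mem_sdiff, mem_cycleVertices_iff, mem_cycleVertices_iff]
  constructor
  · rintro ⟨C', hle', hC', hv⟩
    have h1 : C' ≤ H := hle'.trans sdiff_le
    exact ⟨⟨C', h1, hC', hv⟩, Set.disjoint_left.1 ((hD.le_sdiff_iff hle hC hC' h1).1 hle') hv⟩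
  · rintro ⟨⟨C', hle', hC', hv⟩, hn⟩
    refine ⟨C', (hD.le_sdiff_iff hle hC hC' hle').2 ?_, hC', hv⟩
    rw [Set.disjoint_left]
    intro w hw hw'
    rw [hD C' hle' C hle hC' hC w hw hw'] at hv
    exact hn hv

theorem cycleVertices_isolate (hD : H.DisjointCycles) (hle : C ≤ H) (hC : C.IsCycleGraph) {x : V}
    (hx : x ∈ C.support) : (H.isolate {x}).cycleVertices = H.cycleVertices \ C.support := by
  ext v
  rw [Set.mem_sdiff, mem_cycleVertices_iff, mem_cycleVertices_iff]
  constructor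
  · rintro ⟨C', hle', hC', hv⟩
    obtain ⟨h1, h2⟩ := le_isolate_iff.1 hle'
    refine ⟨⟨C', h1, hC', hv⟩, fun hv' => ?_⟩
    rw [hD C' h1 C hle hC' hC v hv hv'] at h2
    exact Set.disjoint_left.1 h2 hx rfl
  · rintro ⟨⟨C', hle', hC', hv⟩, hn⟩
    refine ⟨C', le_isolate_iff.2 ⟨hle', ?_⟩, hC', hv⟩
    rw [Set.disjoint_singleton_right]
    intro hx'
    rw [hD C' hle' C hle hC' hC x hx' hx] at hv
    exact hn hv

theorem ncard_cycleVertices [Finite V] (hD : H.DisjointCycles) (hle : C ≤ H)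
    (hC : C.IsCycleGraph) :
    H.cycleVertices.ncard = (H \ C).cycleVertices.ncard + C.support.ncard := by
  rw [hD.cycleVertices_sdiff hle hC]
  exact (Set.ncard_sdiff_add_ncard_of_subset (hC.support_subset_cycleVertices hle)
    (Set.toFinite _)).symm

/-- Deleting one edge of `C` lowers the number by one and turns the other edges of `C` into bridges,
whose removal costs nothing. -/
theorem cyclomaticNumber_le_sdiff_add_one [Finite V] (hD : H.DisjointCycles) (hle : C ≤ H)
    (hC : C.IsCycleGraph) : H.cyclomaticNumber ≤ (H \ C).cyclomaticNumber + 1 := by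
  obtain ⟨x, u, hu⟩ := hC.support_nonempty
  have hu : C.Adj x u := hu
  have hb := (not_isBridge_iff_exists_isCycleGraph (hle hu)).2 ⟨C, hle, hC, hu⟩
  have h1 := cyclomaticNumber_deleteEdges_of_not_isBridge (hle hu) hb
  have h2 : (H.deleteEdges {s(x, u)}).cyclomaticNumber ≤ (H \ C).cyclomaticNumber := by
    apply cyclomaticNumber_le_of_forall_isBridge
    · exact le_deleteEdges_singleton sdiff_le fun h => h.2 hu
    · intro v w hvw hn
      have hvw' := deleteEdges_le _ hvw
      by_contra hcon
      obtain ⟨C', hle', hC', hadj⟩ := (not_isBridge_iff_exists_isCycleGraph hvw).1 hcon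
      have hadjC : C.Adj v w := by
        by_contra hc
        exact hn ⟨hvw', hc⟩
      have heq := hD C' (hle'.trans (deleteEdges_le _)) C hle hC' hC v ⟨w, hadj⟩ ⟨w, hadjC⟩
      have := hle' (heq ▸ hu)
      rw [deleteEdges_adj] at this
      exact this.2 rfl
  omega

theorem exists_perfect_isEdgeMatching [Finite V] (hD : H.DisjointCycles)
    (heven : ∀ C ≤ H, C.IsCycleGraph → Even C.support.ncard) :
    ∃ P, H.IsEdgeMatching P ∧ (∀ e ∈ P, ∀ v ∈ e, v ∈ H.cycleVertices) ∧
      2 * P.card = H.cycleVertices.ncard := by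
  classical
  induction H using WellFoundedLT.induction with
  | ind H ih =>
    by_cases hcyc : ∃ C ≤ H, C.IsCycleGraph
    · obtain ⟨C, hle, hC⟩ := hcyc
      obtain ⟨x, hx⟩ := hC.support_nonempty
      have hlt : H \ C < H := by
        obtain ⟨u, hu⟩ := hx
        refine lt_of_le_of_ne sdiff_le fun heq => ?_
        have := hle hu
        rw [← heq] at this
        exact this.2 hu
      obtain ⟨P, hP, hPv, hPc⟩ := ih _ hlt (hD.mono sdiff_le)
        fun C' hle' => heven C' (hle'.trans sdiff_le)
      obtain ⟨k, p, hp, -⟩ := hC.exists_isCycleEnum hx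
      have hk := heven C hle hC
      rw [hp.ncard_support, even_iff_exists_two_mul] at hk
      obtain ⟨r, rfl⟩ := hk
      obtain ⟨M, hM, hMc, hMv⟩ := hp.exists_isEdgeMatching (a := 0) (r := r) (by omega)
      have hMC : ∀ e ∈ M, ∀ v ∈ e, v ∈ C.support := by
        intro e he v hv
        obtain ⟨j, -, hj, rfl⟩ := hMv e he v hv
        exact hp.mem_support_iff.2 ⟨j, by omega, rfl⟩
      rw [hD.cycleVertices_sdiff hle hC] at hPv
      have hdis : ∀ e ∈ P, ∀ f ∈ M, ∀ v, v ∈ e → v ∉ f :=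
        fun e he f hf v hv hvf => (hPv e he v hv).2 (hMC f hf v hvf)
      refine ⟨P ∪ M, (hP.mono sdiff_le).union (hM.mono hle) hdis, fun e he v hv => ?_, ?_⟩
      · rcases Finset.mem_union.1 he with he | he
        · exact (hPv e he v hv).1
        · exact hC.support_subset_cycleVertices hle (hMC e he v hv)
      · rw [card_union_of_no_common_vertex hdis, hD.ncard_cycleVertices hle hC, mul_add, hPc, hMc,
          hp.ncard_support]
    · refine ⟨∅, H.isEdgeMatching_empty, by simp, ?_⟩
      have : H.cycleVertices = ∅ := by
        rw [Set.eq_empty_iff_forall_notMem]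
        intro v hv
        obtain ⟨C, hle, hC, -⟩ := mem_cycleVertices_iff.1 hv
        exact hcyc ⟨C, hle, hC⟩
      simp [this]

theorem le_two_mul_matchingNumber [Finite V] (hD : H.DisjointCycles)
    (heven : ∀ C ≤ H, C.IsCycleGraph → Even C.support.ncard) :
    2 * (H.isolate H.cycleVertices).matchingNumber + H.cycleVertices.ncard ≤
      2 * H.matchingNumber := by
  classical
  obtain ⟨P, hP, hPv, hPc⟩ := hD.exists_perfect_isEdgeMatching heven
  obtain ⟨M, hM, hMc⟩ := (H.isolate H.cycleVertices).exists_isEdgeMatching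
  have hdis : ∀ e ∈ M, ∀ f ∈ P, ∀ v, v ∈ e → v ∉ f :=
    fun e he f hf v hv hvf => (mem_edgeSet_isolate.1 (hM.1 e he)).2 v hv (hPv f hf v hvf)
  have := ((hM.mono (H.isolate_le _)).union hP hdis).card_le
  rw [card_union_of_no_common_vertex hdis] at this
  omega

end DisjointCycles

/-- At most `|K|` edges of a matching meet `K`. The others are not bridges, so all their ends lie on
cycles. -/
theorem two_mul_matchingNumber_le_of_cover [Finite V] {K : Finset V}
    (hK : ∀ u v, H.Adj u v → H.IsBridge s(u, v) → u ∈ K ∨ v ∈ K) :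
    2 * H.matchingNumber ≤ 2 * K.card + H.cycleVertices.ncard := by
  classical
  let _ := Fintype.ofFinite V
  obtain ⟨M, hM, hc⟩ := H.exists_isEdgeMatching
  rw [← hc, ← Finset.card_filter_add_card_filter_not (s := M) (fun e => ∃ v ∈ K, v ∈ e), mul_add]
  apply add_le_add
  · have := (hM.subset (Finset.filter_subset _ _)).card_le_of_cover (K := K)
      (fun e he => (Finset.mem_filter.1 he).2)
    omega
  · rw [Set.ncard_eq_toFinset_card']
    refine (hM.subset (Finset.filter_subset _ _)).two_mul_card_le fun e he v hv => ?_
    obtain ⟨he, hn⟩ := Finset.mem_filter.1 he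
    obtain ⟨u, rfl⟩ := Sym2.mem_iff_exists.1 hv
    rw [Set.mem_toFinset]
    refine (mem_cycleVertices_of_not_isBridge (hM.1 _ he) fun hb => hn ?_).1
    rcases hK v u (hM.1 _ he) hb with h | h
    · exact ⟨v, h, Sym2.mem_mk_left _ _⟩
    · exact ⟨u, h, Sym2.mem_mk_right _ _⟩

/-- Putting a cycle `C` back raises `c` by at most 1 and `n` by at most `|C|/2 - 1`. Without cycles,
`c = 0` and `K` covers every edge. Everything is doubled to avoid halves. -/
theorem DisjointCycles.negIndex_add_cyclomaticNumber_le [Fintype V] {a : V → V → ℂ}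
    (ha : IsUnitGain a) (hD : H.DisjointCycles)
    (hgain : ∀ C ≤ H, C.IsCycleGraph → 2 * ((C.gainMatrix a).negIndex + 1) ≤ C.support.ncard)
    {K : Finset V} (hK : ∀ u v, H.Adj u v → H.IsBridge s(u, v) → u ∈ K ∨ v ∈ K) :
    2 * ((H.gainMatrix a).negIndex : ℤ) + 2 * H.cyclomaticNumber ≤
      2 * K.card + H.cycleVertices.ncard := by
  classical
  induction H using WellFoundedLT.induction with
  | ind H ih =>
    by_cases hcyc : ∃ C ≤ H, C.IsCycleGraph
    · obtain ⟨C, hle, hC⟩ := hcyc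
      have hlt : H \ C < H := by
        obtain ⟨x, u, hu⟩ := hC.support_nonempty
        refine lt_of_le_of_ne sdiff_le fun heq => ?_
        have := hle hu
        rw [← heq] at this
        exact this.2 hu
      have h1 := ih _ hlt (hD.mono sdiff_le) (fun C' hle' => hgain C' (hle'.trans sdiff_le))
        (fun u v huv hb => hK u v huv.1 (hD.sdiff_isBridge hle hC huv hb))
      have h2 := hD.ncard_cycleVertices hle hC
      have h3 := hD.cyclomaticNumber_le_sdiff_add_one hle hC
      have h4 := negIndex_gainMatrix_le_sdiff_add ha hle
      have h5 := hgain C hle hC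
      omega
    · have hbr : ∀ u v, H.Adj u v → H.IsBridge s(u, v) := by
        intro u v huv
        by_contra hn
        obtain ⟨C, hle, hC, -⟩ := (not_isBridge_iff_exists_isCycleGraph huv).1 hn
        exact hcyc ⟨C, hle, hC⟩
      have h1 := negIndex_gainMatrix_le_of_cover (a := a) fun u v huv => hK u v huv (hbr u v huv)
      have h2 := cyclomaticNumber_le_of_forall_isBridge (bot_le (a := H))
        fun u v huv _ => hbr u v huv
      rw [cyclomaticNumber_bot] at h2
      omega

end SimpleGraph

/-! ### Bridge covers of tight graphs -/

namespace SimpleGraph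

variable {V : Type*}

/-- Some vertex set that avoids the cycles of `H` covers the edges of `H` on no cycle, and is no
larger than a matching that avoids the cycles. -/
def HasBridgeCover (H : SimpleGraph V) : Prop :=
  ∃ K : Finset V, (∀ v ∈ K, v ∉ H.cycleVertices) ∧
    (∀ u v, H.Adj u v → H.IsBridge s(u, v) → u ∈ K ∨ v ∈ K) ∧
    K.card ≤ (H.isolate H.cycleVertices).matchingNumber

theorem isolate_isolate (H : SimpleGraph V) (S T : Set V) :
    (H.isolate S).isolate T = H.isolate (S ∪ T) := by
  ext u v
  simp only [isolate_adj, Set.mem_union]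
  tauto

theorem cycleVertices_isolate_of_disjoint {H : SimpleGraph V} {S : Set V}
    (h : ∀ C ≤ H, C.IsCycleGraph → Disjoint C.support S) :
    (H.isolate S).cycleVertices = H.cycleVertices := by
  ext v
  rw [mem_cycleVertices_iff, mem_cycleVertices_iff]
  constructor
  · rintro ⟨C, hle, hC, hv⟩
    exact ⟨C, hle.trans (H.isolate_le _), hC, hv⟩
  · rintro ⟨C, hle, hC, hv⟩
    exact ⟨C, le_isolate_iff.2 ⟨hle, h C hle hC⟩, hC, hv⟩

/-- A bridge cover extends over a pendant edge with no end on a cycle. -/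
theorem HasBridgeCover.of_pendant [Finite V] {H : SimpleGraph V} {x y : V} (hxy : H.Adj x y)
    (hx : ∀ z, H.Adj x z → z = y) (hdis : ∀ C ≤ H, C.IsCycleGraph → Disjoint C.support {x, y})
    (h : (H.isolate {x, y}).HasBridgeCover) : H.HasBridgeCover := by
  classical
  obtain ⟨K, hK1, hK2, hK3⟩ := h
  rw [cycleVertices_isolate_of_disjoint hdis] at hK1 hK3
  have hnot : ∀ v ∈ ({x, y} : Set V), v ∉ H.cycleVertices := by
    intro v hv hvO
    obtain ⟨C, hle, hC, hvC⟩ := mem_cycleVertices_iff.1 hvO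
    exact Set.disjoint_left.1 (hdis C hle hC) hvC hv
  refine ⟨insert y K, ?_, ?_, ?_⟩
  · intro v hv
    rcases Finset.mem_insert.1 hv with rfl | hv
    · exact hnot v (by simp)
    · exact hK1 v hv
  · intro u v huv hb
    by_cases hu : u = y
    · exact Or.inl (by simp [hu])
    by_cases hv : v = y
    · exact Or.inr (by simp [hv])
    have hux : u ≠ x := by
      rintro rfl
      exact hv (hx v huv)
    have hvx : v ≠ x := by
      rintro rfl
      exact hu (hx u huv.symm)
    rcases hK2 u v ⟨huv, by simp [hu, hux], by simp [hv, hvx]⟩ (hb.anti (H.isolate_le _)) with h | h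
    · exact Or.inl (Finset.mem_insert_of_mem h)
    · exact Or.inr (Finset.mem_insert_of_mem h)
  · have hadj : (H.isolate H.cycleVertices).Adj x y := ⟨hxy, hnot x (by simp), hnot y (by simp)⟩
    have h1 := matchingNumber_isolate_pair_add_one_le hadj
    rw [isolate_isolate, Set.union_comm, ← isolate_isolate] at h1
    have h2 := Finset.card_insert_le y K
    omega

/-- Take a bridge `xy` with bridgeless side of `x`. If `x` is a leaf, `of_pendant` applies.
Otherwise that side is one cycle `C` of length `2r`, joined to the rest only by `xy`. The graphs `H
- x` and `H - p 1`, with `p 1` next to `x` on `C`, are tight with equal matching numbers. Comparing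
them shows that the inductive cover `K` of `H - p 1` has at most `m(H - O(H)) + r - 1` vertices;
this excludes `x` from `K`, so `y` covers `xy`, and the part of `K` off `C` is the cover sought. -/
theorem IsTight.hasBridgeCover [Fintype V] {a : V → V → ℂ} (ha : IsUnitGain a)
    {H : SimpleGraph V} (h : H.IsTight a) : H.HasBridgeCover := by
  classical
  induction H using WellFoundedLT.induction with
  | ind H ih =>
    have hD := h.disjointCycles ha
    by_cases hbr : ∀ u v, H.Adj u v → ¬ H.IsBridge s(u, v)
    · exact ⟨∅, by simp, fun u v huv hb => absurd hb (hbr u v huv), by simp⟩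
    push Not at hbr
    obtain ⟨x, y, hxy, hb⟩ := hbr
    obtain ⟨x, y, hxy, hb, -, hmin⟩ := exists_isBridge_edgeSide_minimal hxy hb
    by_cases hx : ∀ z, H.Adj x z → z = y
    · obtain ⟨ht, hdis⟩ := h.isolate_pendant ha hxy hx
      exact (ih _ (isolate_lt hxy (by simp)) ht).of_pendant hxy hx hdis
    push Not at hx
    obtain ⟨z, hxz, hzy⟩ := hx
    have hzs : z ∈ H.edgeSide x y := mem_edgeSide_of_adj (mem_edgeSide_self H x y) hxz
      fun he => hzy (Sym2.congr_right.1 he)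
    obtain ⟨C, hle, hC, hCxz⟩ := (not_isBridge_iff_exists_isCycleGraph hxz).1
      (hmin x z hxz (mem_edgeSide_self H x y) hzs)
    have hxC : x ∈ C.support := ⟨z, hCxz⟩
    obtain ⟨k, p, hp, hp0⟩ := hC.exists_isCycleEnum hxC
    have heven : ∀ H' ≤ H, ∀ C ≤ H', C.IsCycleGraph → Even C.support.ncard := by
      intro H' hH' D hDle hDc
      obtain ⟨v, hv⟩ := hDc.support_nonempty
      obtain ⟨k, p, hp, -⟩ := hDc.exists_isCycleEnum hv
      rw [hp.ncard_support]
      exact (h.isCycleEnum_gain ha (hDle.trans hH') hDc hp).1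
    have hk := heven H le_rfl C hle hC
    rw [hp.ncard_support, even_iff_exists_two_mul] at hk
    obtain ⟨r, rfl⟩ := hk
    have h3 := hp.three_le
    have hCside : ∀ v ∈ C.support, v ∈ H.edgeSide x y := fun v hv =>
      (hC.reachable hxC hv).mono (le_deleteEdges_singleton hle
        fun hadj => hC.not_isBridge hadj (hb.anti hle))
    -- Every edge inside the side lies on a cycle, and a cycle that meets `C` is `C`; so the side
    -- does not extend beyond `C`.
    have hsideC : ∀ v ∈ H.edgeSide x y, v ∈ C.support := by
      intro v hv
      refine (Reachable.mem_of_closed (S := {v | v ∈ C.support ∧ v ∈ H.edgeSide x y}) hv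
        ⟨hxC, mem_edgeSide_self H x y⟩ ?_).1
      rintro u ⟨huC, hus⟩ w huw
      have hadj := deleteEdges_le _ huw
      have hws : w ∈ H.edgeSide x y := Reachable.trans hus huw.reachable
      obtain ⟨C', hle', hC', huw'⟩ := (not_isBridge_iff_exists_isCycleGraph hadj).1
        (hmin u w hadj hus hws)
      rw [hD C' hle' C hle hC' hC u ⟨w, huw'⟩ huC] at huw'
      exact ⟨⟨u, huw'.symm⟩, hws⟩
    have hyC : y ∉ C.support := fun hy => notMem_edgeSide hb (hCside y hy)
    have hnbr : ∀ u ∈ C.support, ∀ v, H.Adj u v → v ∈ C.support ∨ (u = x ∧ v = y) := by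
      intro u hu v huv
      by_cases he : s(u, v) = s(x, y)
      · rcases Sym2.eq_iff.1 he with he | ⟨rfl, -⟩
        · exact Or.inr he
        · exact absurd hu hyC
      · exact Or.inl (hsideC v (mem_edgeSide_of_adj (hCside u hu) huv he))
    have hCO : C.support ⊆ H.cycleVertices := hC.support_subset_cycleVertices hle
    have hx'C : p 1 ∈ C.support := hp.mem_support_iff.2 ⟨1, by omega, rfl⟩
    have hxx' : x ≠ p 1 := by
      intro he
      have := hp.injOn (show 0 < _ by omega) (show 1 < _ by omega) (hp0.trans he)
      omega
    -- the graphs obtained by deleting `x` or its neighbour `p 1` on `C`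
    obtain ⟨ht1, hm1, -⟩ := h.isolate_singleton ha hle hC hxC
    obtain ⟨ht2, hm2, -⟩ := h.isolate_singleton ha hle hC hx'C
    have hlt : ∀ v ∈ C.support, H.isolate {v} < H := by
      rintro v ⟨u, hu⟩
      exact isolate_lt (hle hu) (Set.mem_singleton v)
    obtain ⟨K₁, hK₁, hK₁', hK₁c⟩ := ih _ (hlt x hxC) ht1
    obtain ⟨K, hK, hK', hKc⟩ := ih _ (hlt _ hx'C) ht2
    have hF1 := two_mul_matchingNumber_le_of_cover hK₁'
    have hF2 := (hD.mono (H.isolate_le {p 1})).le_two_mul_matchingNumber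
      (heven _ (H.isolate_le {p 1}))
    rw [hD.cycleVertices_isolate hle hC hxC] at hF1 hK₁c
    rw [hD.cycleVertices_isolate hle hC hx'C] at hF2 hK hKc
    -- matchings of `H - x` avoiding the other cycles
    have hM1 : ((H.isolate {x}).isolate (H.cycleVertices \ C.support)).matchingNumber + 1 ≤
        (H.isolate H.cycleVertices).matchingNumber + r := by
      obtain ⟨M, hM, hMc⟩ := ((H.isolate {x}).isolate (H.cycleVertices \ C.support)).exists_isEdgeMatching
      have hedge : ∀ u v, s(u, v) ∈ M → u ∈ C.support → u ≠ x ∧ v ∈ C.support := by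
        intro u v huv hu
        have hadj : ((H.isolate {x}).isolate (H.cycleVertices \ C.support)).Adj u v := hM.1 _ huv
        have hux : u ≠ x := hadj.1.2.1
        exact ⟨hux, (hnbr u hu v hadj.1.1).resolve_right fun hxy => hux hxy.1⟩
      rw [← hMc, ← Finset.card_filter_add_card_filter_not (s := M) (fun e => ∃ v ∈ e, v ∈ C.support)]
      have h1 : 2 * (M.filter fun e => ∃ v ∈ e, v ∈ C.support).card ≤
          (C.support.toFinset.erase x).card := by
        refine (hM.subset (Finset.filter_subset _ _)).two_mul_card_le fun e he v hv => ?_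
        obtain ⟨he, w, hw, hwC⟩ := Finset.mem_filter.1 he
        rw [Finset.mem_erase, Set.mem_toFinset]
        obtain ⟨u, rfl⟩ := Sym2.mem_iff_exists.1 hw
        have h2 := hedge w u he hwC
        rcases Sym2.mem_iff.1 hv with rfl | rfl
        · exact ⟨h2.1, hwC⟩
        · exact ⟨(hedge v w (by rwa [Sym2.eq_swap]) h2.2).1, h2.2⟩
      rw [Finset.card_erase_of_mem (Set.mem_toFinset.2 hxC), ← Set.ncard_eq_toFinset_card',
        hp.ncard_support] at h1
      have h2 : (M.filter fun e => ¬ ∃ v ∈ e, v ∈ C.support).card ≤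
          (H.isolate H.cycleVertices).matchingNumber := by
        refine IsEdgeMatching.card_le ⟨fun e he => ?_, (hM.subset (Finset.filter_subset _ _)).2⟩
        obtain ⟨he, hn⟩ := Finset.mem_filter.1 he
        obtain ⟨h3, h4⟩ := mem_edgeSet_isolate.1 (hM.1 e he)
        exact mem_edgeSet_isolate.2 ⟨edgeSet_mono (H.isolate_le _) h3,
          fun v hv hvO => h4 v hv ⟨hvO, fun hvC => hn ⟨v, hv, hvC⟩⟩⟩
      omega
    -- the cover of `H - p 1` on the cycle `C`
    have hcov : ∀ u v, H.Adj u v → u ≠ p 1 → v ≠ p 1 → (H.isolate {p 1}).IsBridge s(u, v) →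
        u ∈ K ∨ v ∈ K := fun u v huv hu hv hbr => hK' u v ⟨huv, hu, hv⟩ hbr
    -- In `H - p 1` the remaining edges of `C` are bridges. The `r - 1` disjoint ones starting at `p
    -- 2` must be covered by vertices other than `x`.
    have hcard : r ≤ (K.filter fun v => v ∈ C.support ∧ v ≠ x).card + 1 := by
      obtain ⟨M, hM, hMc, hMv⟩ := hp.exists_isEdgeMatching (a := 2) (r := r - 1) (by omega)
      have := hM.card_le_of_cover (K := K.filter fun v => v ∈ C.support ∧ v ≠ x) ?_
      · omega
      intro e he
      have hmem : ∀ v ∈ e, v ∈ C.support ∧ v ≠ x ∧ v ≠ p 1 := by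
        intro v hv
        obtain ⟨j, hj, hj', rfl⟩ := hMv e he v hv
        refine ⟨hp.mem_support_iff.2 ⟨j, by omega, rfl⟩, fun hj0 => ?_, fun hj1 => ?_⟩
        · have := hp.injOn (show j < _ by omega) (show 0 < _ by omega) (hj0.trans hp0.symm)
          omega
        · have := hp.injOn (show j < _ by omega) (show 1 < _ by omega) hj1
          omega
      induction e with
      | h u v =>
        have hu := hmem u (Sym2.mem_mk_left _ _)
        have hv := hmem v (Sym2.mem_mk_right _ _)
        have huv : C.Adj u v := hM.1 _ he
        have hbr : (H.isolate {p 1}).IsBridge s(u, v) := by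
          by_contra hn
          have := (mem_cycleVertices_of_not_isBridge
            (show (H.isolate {p 1}).Adj u v from ⟨hle huv, hu.2.2, hv.2.2⟩) hn).1
          rw [hD.cycleVertices_isolate hle hC hx'C] at this
          exact this.2 hu.1
        rcases hcov u v (hle huv) hu.2.2 hv.2.2 hbr with hk | hk
        · exact ⟨u, Finset.mem_filter.2 ⟨hk, hu.1, hu.2.1⟩, Sym2.mem_mk_left _ _⟩
        · exact ⟨v, Finset.mem_filter.2 ⟨hk, hv.1, hv.2.1⟩, Sym2.mem_mk_right _ _⟩
    -- With `Q` the cycle vertices off `C`: `|K| ≤ m(H - p 1 - Q) ≤ m(H - p 1) - |Q|/2 = m(H - x) -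
    -- |Q|/2 ≤ |K₁| ≤ m(H - x - Q)`, and `hM1` bounds the last term.
    have hbound : K.card + 1 ≤ (H.isolate H.cycleVertices).matchingNumber + r := by omega
    have hsplit := Finset.card_filter_add_card_filter_not (s := K) (fun v => v ∈ C.support)
    -- Otherwise `K` has at least `r` vertices on `C`, and off `C` it still covers `H - O(H)`, which
    -- contradicts `hbound`.
    have hxK : x ∉ K := by
      intro hxK
      have h1 : (K.filter fun v => v ∈ C.support ∧ v ≠ x).card + 1 ≤
          (K.filter fun v => v ∈ C.support).card := by
        rw [← Finset.card_insert_of_notMem (a := x) (by simp)]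
        apply Finset.card_le_card
        intro v hv
        rcases Finset.mem_insert.1 hv with rfl | hv
        · exact Finset.mem_filter.2 ⟨hxK, hxC⟩
        · rw [Finset.mem_filter] at hv ⊢
          exact ⟨hv.1, hv.2.1⟩
      have h2 : (H.isolate H.cycleVertices).matchingNumber ≤ (K.filter fun v => ¬ v ∈ C.support).card := by
        refine matchingNumber_le fun M hM => hM.card_le_of_cover fun e he => ?_
        have hadj := hM.1 e he
        induction e with
        | h u v =>
          have huC : u ∉ C.support := fun hu => hadj.2.1 (hCO hu)
          have hvC : v ∉ C.support := fun hv => hadj.2.2 (hCO hv)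
          have hbr : H.IsBridge s(u, v) := by
            by_contra hn
            exact hadj.2.1 (mem_cycleVertices_of_not_isBridge hadj.1 hn).1
          rcases hcov u v hadj.1 (fun he => huC (he ▸ hx'C)) (fun he => hvC (he ▸ hx'C))
            (hbr.anti (H.isolate_le _)) with hk | hk
          · exact ⟨u, Finset.mem_filter.2 ⟨hk, huC⟩, Sym2.mem_mk_left _ _⟩
          · exact ⟨v, Finset.mem_filter.2 ⟨hk, hvC⟩, Sym2.mem_mk_right _ _⟩
      omega
    have hyK : y ∈ K := (hcov x y hxy hxx' (fun he => hyC (he ▸ hx'C))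
      (hb.anti (H.isolate_le _))).resolve_left hxK
    refine ⟨K.filter fun v => ¬ v ∈ C.support, ?_, ?_, ?_⟩
    · intro v hv hvO
      obtain ⟨h1, h2⟩ := Finset.mem_filter.1 hv
      exact hK v h1 ⟨hvO, h2⟩
    · have hyF : y ∈ K.filter fun v => ¬ v ∈ C.support := Finset.mem_filter.2 ⟨hyK, hyC⟩
      intro u v huv hbr
      by_cases hu : u ∈ C.support
      · rcases hnbr u hu v huv with hv | ⟨-, rfl⟩
        · exact absurd hbr (hmin u v huv (hCside u hu) (hCside v hv))
        · exact Or.inr hyF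
      by_cases hv : v ∈ C.support
      · rcases hnbr v hv u huv.symm with hu' | ⟨-, rfl⟩
        · exact absurd hu' hu
        · exact Or.inl hyF
      rcases hcov u v huv (fun he => hu (he ▸ hx'C)) (fun he => hv (he ▸ hx'C))
        (hbr.anti (H.isolate_le _)) with hk | hk
      · exact Or.inl (Finset.mem_filter.2 ⟨hk, hu⟩)
      · exact Or.inr (Finset.mem_filter.2 ⟨hk, hv⟩)
    · have h1 : (K.filter fun v => v ∈ C.support ∧ v ≠ x).card ≤
          (K.filter fun v => v ∈ C.support).card := by
        apply Finset.card_le_card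
        intro v hv
        rw [Finset.mem_filter] at hv ⊢
        exact ⟨hv.1, hv.2.1⟩
      omega

end SimpleGraph

/-! ### The contraction `T_G` and its covers -/

namespace SimpleGraph

variable {V : Type*}

theorem IsCycleGraph.reachable_deleteEdges_of_isBridge {H C : SimpleGraph V}
    (hC : C.IsCycleGraph) (hle : C ≤ H) {u v x y : V} (hb : H.IsBridge s(x, y))
    (hu : u ∈ C.support) (hv : v ∈ C.support) : (H.deleteEdges {s(x, y)}).Reachable u v :=
  (hC.reachable hu hv).mono (le_deleteEdges_singleton hle
    fun hadj => hC.not_isBridge hadj (hb.anti hle))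

/-- Forests have a vertex cover no larger than a matching. -/
theorem exists_cover_card_le_matchingNumber [Finite V] {H : SimpleGraph V}
    (hbr : ∀ u v, H.Adj u v → H.IsBridge s(u, v)) :
    ∃ K : Finset V, (∀ u v, H.Adj u v → u ∈ K ∨ v ∈ K) ∧ K.card ≤ H.matchingNumber := by
  have hnone : ∀ {H : SimpleGraph V}, (∀ u v, H.Adj u v → H.IsBridge s(u, v)) → ∀ C ≤ H,
      ¬ C.IsCycleGraph := by
    intro H hbr C hle hC
    obtain ⟨x, u, hu⟩ := hC.support_nonempty
    exact hC.not_isBridge hu ((hbr x u (hle hu)).anti hle)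
  -- In a forest all edges are bridges and no vertex lies on a cycle, so a bridge cover is a vertex
  -- cover and `of_pendant` gives the induction.
  have key : H.HasBridgeCover := by
    induction H using WellFoundedLT.induction with
    | ind H ih =>
      by_cases hbot : ∀ u v, ¬ H.Adj u v
      · exact ⟨∅, by simp, fun u v huv => absurd huv (hbot u v), by simp⟩
      push Not at hbot
      obtain ⟨x, y, hxy⟩ := hbot
      obtain ⟨x, y, hxy, -, -, hmin⟩ := exists_isBridge_edgeSide_minimal hxy (hbr x y hxy)
      refine (ih _ (isolate_lt (S := {x, y}) hxy (by simp)) fun u v huv => ?_).of_pendant hxy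
        (eq_of_adj_of_edgeSide_minimal hmin (hbr x)) fun C hle hC => absurd hC (hnone hbr C hle)
      exact (hbr u v huv.1).anti (H.isolate_le _)
  obtain ⟨K, -, hK, hc⟩ := key
  exact ⟨K, fun u v huv => hK u v huv (hbr u v huv),
    hc.trans (matchingNumber_mono (H.isolate_le _))⟩

section Contraction

variable {G : SimpleGraph V}

/-- Disjointness makes the relation "equal or on a common cycle" transitive, so the generated
equivalence is no larger. -/
theorem eq_or_of_quot_mk_eq (hD : G.DisjointCycles) {u v : V}
    (h : Quot.mk G.OnCommonCycle u = Quot.mk G.OnCommonCycle v) :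
    u = v ∨ ∃ C ≤ G, C.IsCycleGraph ∧ u ∈ C.support ∧ v ∈ C.support := by
  rw [Quot.eq] at h
  induction h with
  | rel u v h => exact Or.inr (onCommonCycle_iff.1 h)
  | refl u => exact Or.inl rfl
  | symm u v _ ih =>
    rcases ih with rfl | ⟨C, h1, h2, h3, h4⟩
    · exact Or.inl rfl
    · exact Or.inr ⟨C, h1, h2, h4, h3⟩
  | trans u v w _ _ ih1 ih2 =>
    rcases ih1 with rfl | ⟨C, h1, h2, h3, h4⟩
    · exact ih2
    · rcases ih2 with rfl | ⟨C', h1', h2', h3', h4'⟩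
      · exact Or.inr ⟨C, h1, h2, h3, h4⟩
      · obtain rfl := hD C h1 C' h1' h2 h2' v h4 h3'
        exact Or.inr ⟨C, h1, h2, h3, h4'⟩

theorem injOn_quot_mk (hD : G.DisjointCycles) :
    Set.InjOn (Quot.mk G.OnCommonCycle) G.cycleVerticesᶜ := by
  intro u hu v _ huv
  rcases eq_or_of_quot_mk_eq hD huv with h | ⟨C, h1, h2, h3, -⟩
  · exact h
  · exact absurd (h2.support_subset_cycleVertices h1 h3) hu

theorem eq_of_quot_mk_eq (hD : G.DisjointCycles) {u v : V} (hu : u ∉ G.cycleVertices)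
    (h : Quot.mk G.OnCommonCycle u = Quot.mk G.OnCommonCycle v) : u = v := by
  rcases eq_or_of_quot_mk_eq hD h with h | ⟨C, h1, h2, h3, -⟩
  · exact h
  · exact absurd (h2.support_subset_cycleVertices h1 h3) hu

theorem cycleContraction_adj_of_isBridge (hD : G.DisjointCycles) {u v : V} (huv : G.Adj u v)
    (hb : G.IsBridge s(u, v)) :
    G.cycleContraction.Adj (Quot.mk _ u) (Quot.mk _ v) := by
  refine ⟨fun h => ?_, u, v, huv, rfl, rfl⟩
  rcases eq_or_of_quot_mk_eq hD h with h | ⟨C, h1, h2, h3, h4⟩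
  · exact huv.ne h
  · exact hb (h2.reachable_deleteEdges_of_isBridge h1 hb h3 h4)

theorem exists_isBridge_of_cycleContraction_adj {q r : Quot G.OnCommonCycle}
    (h : G.cycleContraction.Adj q r) : ∃ u v, G.Adj u v ∧ G.IsBridge s(u, v) ∧
      Quot.mk _ u = q ∧ Quot.mk _ v = r := by
  obtain ⟨hne, u, v, huv, rfl, rfl⟩ := h
  refine ⟨u, v, huv, ?_, rfl, rfl⟩
  by_contra hn
  obtain ⟨C, hle, hC, hadj⟩ := (not_isBridge_iff_exists_isCycleGraph huv).1 hn
  exact hne (Quot.sound (onCommonCycle_iff.2 ⟨C, hle, hC, ⟨v, hadj⟩, ⟨u, hadj.symm⟩⟩))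

/-- Each step of a walk in `T_G` lifts to an edge of `G`; inside a class one moves along a cycle,
which does not use the bridge. -/
theorem reachable_of_cycleContraction (hD : G.DisjointCycles) {u v : V} (hb : G.IsBridge s(u, v))
    {q r : Quot G.OnCommonCycle}
    (h : (G.cycleContraction.deleteEdges {s(Quot.mk _ u, Quot.mk _ v)}).Reachable q r) :
    ∀ a b, Quot.mk _ a = q → Quot.mk _ b = r → (G.deleteEdges {s(u, v)}).Reachable a b := by
  have hclass : ∀ a b, Quot.mk G.OnCommonCycle a = Quot.mk _ b →
      (G.deleteEdges {s(u, v)}).Reachable a b := by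
    intro a b hab
    rcases eq_or_of_quot_mk_eq hD hab with rfl | ⟨C, h1, h2, h3, h4⟩
    · exact Reachable.refl _
    · exact h2.reachable_deleteEdges_of_isBridge h1 hb h3 h4
  obtain ⟨w⟩ := h
  induction w with
  | nil => exact fun a b ha hb => hclass a b (ha.trans hb.symm)
  | cons hqr _ ih =>
    intro a b ha hb'
    rw [deleteEdges_adj] at hqr
    obtain ⟨⟨-, c, d, hcd, rfl, rfl⟩, hne⟩ := hqr
    refine (hclass a c ha).trans (Reachable.trans (Adj.reachable ?_) (ih d b rfl hb'))
    rw [deleteEdges_adj]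
    refine ⟨hcd, fun he => hne ?_⟩
    have he' : s(c, d) = s(u, v) := he
    exact congrArg (Sym2.map (Quot.mk G.OnCommonCycle)) he'

/-- Contracting pairwise disjoint cycles yields a forest. -/
theorem cycleContraction_isBridge (hD : G.DisjointCycles) {q r : Quot G.OnCommonCycle}
    (h : G.cycleContraction.Adj q r) : G.cycleContraction.IsBridge s(q, r) := by
  obtain ⟨u, v, huv, hb, rfl, rfl⟩ := exists_isBridge_of_cycleContraction_adj h
  exact fun hr => hb (reachable_of_cycleContraction hD hb hr u v rfl rfl)

variable [Finite V]

theorem matchingNumber_isolate_le_cycleContraction (hD : G.DisjointCycles) :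
    (G.isolate G.cycleVertices).matchingNumber ≤ G.cycleContraction.matchingNumber := by
  classical
  refine matchingNumber_le fun M hM => ?_
  have hadj : ∀ u v, s(u, v) ∈ M →
      G.cycleContraction.Adj (Quot.mk G.OnCommonCycle u) (Quot.mk G.OnCommonCycle v) := by
    intro u v huv
    have h := hM.1 _ huv
    exact ⟨fun he => h.1.ne (eq_of_quot_mk_eq hD h.2.1 he), u, v, h.1, rfl, rfl⟩
  obtain ⟨h1, h2⟩ := hM.image (f := Quot.mk G.OnCommonCycle)
    (fun e he v hv => (mem_edgeSet_isolate.1 (hM.1 e he)).2 v hv) (injOn_quot_mk hD) hadj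
  exact h2 ▸ h1.card_le

/-- A bridge cover projects to a vertex cover of `T_G`. Conversely, let `L` be a cover of the forest
`T_G` of size at most `m(T_G) = m(G - O(G))`. Its classes off the cycles already cover `G - O(G)`,
so they number at least `m(G - O(G))` and exhaust `L`; hence `L` lifts to vertices off the cycles.
-/
theorem hasBridgeCover_iff_matchingNumber_cycleContraction (hD : G.DisjointCycles) :
    G.HasBridgeCover ↔
      G.cycleContraction.matchingNumber = (G.isolate G.cycleVertices).matchingNumber := by
  classical
  have hge := matchingNumber_isolate_le_cycleContraction hD
  constructor
  · rintro ⟨K, -, hK, hc⟩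
    refine le_antisymm (le_trans (matchingNumber_le fun M hM => ?_) hc) hge
    refine (hM.card_le_of_cover (K := K.image (Quot.mk G.OnCommonCycle)) fun e he => ?_).trans
      Finset.card_image_le
    have hadj := hM.1 e he
    induction e with
    | h q r =>
      obtain ⟨u, v, huv, hb, rfl, rfl⟩ := exists_isBridge_of_cycleContraction_adj hadj
      rcases hK u v huv hb with h | h
      · exact ⟨_, Finset.mem_image_of_mem _ h, Sym2.mem_mk_left _ _⟩
      · exact ⟨_, Finset.mem_image_of_mem _ h, Sym2.mem_mk_right _ _⟩
  · intro hc
    let _ := Fintype.ofFinite V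
    obtain ⟨L, hL, hLc⟩ := exists_cover_card_le_matchingNumber
      (H := G.cycleContraction) fun q r h => cycleContraction_isBridge hD h
    let K : Finset V :=
      Finset.univ.filter fun v => v ∉ G.cycleVertices ∧ Quot.mk G.OnCommonCycle v ∈ L
    have hmemK : ∀ v, v ∈ K ↔ v ∉ G.cycleVertices ∧ Quot.mk G.OnCommonCycle v ∈ L := by
      intro v
      simp [K]
    have hKimg : (K.image (Quot.mk G.OnCommonCycle)).card = K.card :=
      Finset.card_image_of_injOn ((injOn_quot_mk hD).mono fun v hv => ((hmemK v).1 hv).1)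
    have hsub : K.image (Quot.mk G.OnCommonCycle) ⊆ L := by
      intro q hq
      obtain ⟨v, hv, rfl⟩ := Finset.mem_image.1 hq
      exact ((hmemK v).1 hv).2
    have hcov : ∀ u v, G.Adj u v → G.IsBridge s(u, v) →
        Quot.mk G.OnCommonCycle u ∈ L ∨ Quot.mk G.OnCommonCycle v ∈ L :=
      fun u v huv hb => hL _ _ (cycleContraction_adj_of_isBridge hD huv hb)
    have hle : (G.isolate G.cycleVertices).matchingNumber ≤ K.card := by
      refine matchingNumber_le fun M hM => hM.card_le_of_cover fun e he => ?_
      have hadj := hM.1 e he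
      induction e with
      | h u v =>
        have hb : G.IsBridge s(u, v) := by
          by_contra hn
          exact hadj.2.1 (mem_cycleVertices_of_not_isBridge hadj.1 hn).1
        rcases hcov u v hadj.1 hb with h | h
        · exact ⟨u, (hmemK u).2 ⟨hadj.2.1, h⟩, Sym2.mem_mk_left _ _⟩
        · exact ⟨v, (hmemK v).2 ⟨hadj.2.2, h⟩, Sym2.mem_mk_right _ _⟩
    have himg : K.image (Quot.mk G.OnCommonCycle) = L :=
      Finset.eq_of_subset_of_card_le hsub (by omega)
    have hout : ∀ u, Quot.mk G.OnCommonCycle u ∈ L → u ∈ K := by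
      intro u hu
      rw [← himg] at hu
      obtain ⟨v, hv, huv⟩ := Finset.mem_image.1 hu
      exact eq_of_quot_mk_eq hD ((hmemK v).1 hv).1 huv ▸ hv
    refine ⟨K, fun v hv => ((hmemK v).1 hv).1, fun u v huv hb => ?_, ?_⟩
    · exact (hcov u v huv hb).imp (hout u) (hout v)
    · rw [← hKimg, himg]
      omega

end Contraction

end SimpleGraph

/-! ### Unit gain graphs and the theorem -/

namespace UnitGainGraph

variable {V : Type*}

open Classical in
/-- The gain function of `Φ`, extended by `1` to pairs of nonadjacent vertices. -/
noncomputable def totalGain (Φ : UnitGainGraph V) (u v : V) : ℂ :=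
  if h : Φ.graph.Adj u v then (Φ.gain ⟨(u, v), h⟩ : ℂ) else 1

theorem isUnitGain_totalGain (Φ : UnitGainGraph V) : IsUnitGain Φ.totalGain where
  conj_eq u v := by
    by_cases h : Φ.graph.Adj u v
    · have hs : Φ.gain ⟨(v, u), h.symm⟩ = (Φ.gain ⟨(u, v), h⟩)⁻¹ := Φ.gain_symm ⟨(u, v), h⟩
      rw [totalGain, totalGain, dif_pos h, dif_pos h.symm, hs, Circle.coe_inv_eq_conj]
      rfl
    · rw [totalGain, totalGain, dif_neg h, dif_neg fun k => h k.symm, star_one]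
  norm_eq u v := by
    by_cases h : Φ.graph.Adj u v
    · rw [totalGain, dif_pos h, Circle.norm_coe]
    · rw [totalGain, dif_neg h, norm_one]

theorem gainMatrix_totalGain (Φ : UnitGainGraph V) :
    Φ.graph.gainMatrix Φ.totalGain = Φ.adjMatrix := by
  ext u v
  by_cases h : Φ.graph.Adj u v
  · rw [SimpleGraph.gainMatrix_apply_of_adj _ h]
    simp [adjMatrix, totalGain, h]
  · rw [SimpleGraph.gainMatrix_apply_of_not_adj _ h]
    simp [adjMatrix, h]

theorem negInertia_eq_negIndex [Fintype V] [DecidableEq V] (Φ : UnitGainGraph V) :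
    Φ.negInertia = (Φ.graph.gainMatrix Φ.totalGain).negIndex := by
  rw [gainMatrix_totalGain, Φ.adjMatrix_isHermitian.negIndex_eq_card, negInertia,
    Nat.card_eq_fintype_card]

theorem coe_walkGain (Φ : UnitGainGraph V) {u v : V} (w : Φ.graph.Walk u v) :
    (Φ.walkGain w : ℂ) =
      ∏ i ∈ Finset.range w.length, Φ.totalGain (w.getVert i) (w.getVert (i + 1)) := by
  induction w with
  | nil => simp [walkGain]
  | @cons u v w h p ih =>
    rw [SimpleGraph.Walk.length_cons, Finset.prod_range_succ']
    simp only [SimpleGraph.Walk.getVert_cons_succ, SimpleGraph.Walk.getVert_zero]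
    rw [← ih, walkGain, walkGain, SimpleGraph.Walk.darts_cons, List.map_cons, List.prod_cons,
      Circle.coe_mul, mul_comm, totalGain, dif_pos h]

end UnitGainGraph

theorem theorem3p11 {V : Type*} [Fintype V] [DecidableEq V] (Φ : UnitGainGraph V)
    (hconn : Φ.graph.Connected) :
    (Φ.negInertia : ℤ) = (Φ.graph.matchingNumber : ℤ) - Φ.graph.cyclomaticNumber ↔
      Φ.graph.CyclesVertexDisjoint ∧
      Φ.CyclesTypeA ∧
      Φ.graph.cycleContraction.matchingNumber =
        (Φ.graph.induce (Φ.graph.cycleVertices)ᶜ).matchingNumber := by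
  have ha := Φ.isUnitGain_totalGain
  rw [Φ.negInertia_eq_negIndex, SimpleGraph.matchingNumber_induce_compl,
    SimpleGraph.cyclesVertexDisjoint_iff]
  constructor
  · intro h
    have ht : Φ.graph.IsTight Φ.totalGain := by
      unfold SimpleGraph.IsTight
      omega
    have hD := ht.disjointCycles ha
    refine ⟨hD, fun v w hw => ?_,
      (SimpleGraph.hasBridgeCover_iff_matchingNumber_cycleContraction hD).1 (ht.hasBridgeCover ha)⟩
    obtain ⟨h1, h2⟩ := ht.isCycleEnum_gain ha w.toSubgraph.spanningCoe_le hw.isCycleGraph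
      hw.isCycleEnum
    exact ⟨h1, by rw [Φ.coe_walkGain, h2]⟩
  · rintro ⟨hD, hA, hm⟩
    obtain ⟨K, -, hK, hKc⟩ :=
      (SimpleGraph.hasBridgeCover_iff_matchingNumber_cycleContraction hD).2 hm
    have hcyc : ∀ C ≤ Φ.graph, C.IsCycleGraph → Even C.support.ncard ∧
        2 * ((C.gainMatrix Φ.totalGain).negIndex + 1) ≤ C.support.ncard := by
      intro C hle hC
      obtain ⟨x, w, hw, rfl⟩ := hC.exists_walk hle
      obtain ⟨h1, h2⟩ := hA x w hw
      have hp := hw.isCycleEnum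
      rw [hp.ncard_support]
      refine ⟨h1, ?_⟩
      rw [Φ.coe_walkGain] at h2
      obtain ⟨r, hr⟩ := even_iff_exists_two_mul.1 h1
      rw [hr] at hp h2 ⊢
      rw [Nat.mul_div_cancel_left r two_pos] at h2
      have := hp.negIndex_add_one_le ha h2
      omega
    -- With `hKc` and `hm`, `2n + 2c ≤ 2|K| + |O(G)| ≤ 2m`; the general lower bound `h3` is the
    -- reverse inequality.
    have h1 := hD.negIndex_add_cyclomaticNumber_le ha (fun C hle hC => (hcyc C hle hC).2) hK
    have h2 := hD.le_two_mul_matchingNumber fun C hle hC => (hcyc C hle hC).1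
    have h3 := SimpleGraph.matchingNumber_le_negIndex_add_cyclomaticNumber ha Φ.graph
    omega
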